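/- Let $E=(E^0,E^1,r,s)$ be a row-finite directed graph with $E^0,E^1$ countable (each vertex emits finitely many edges), and let $E^*$ be the set of finite paths $\mu=e_1\cdots e_n$, $n\ge 0$, $r(e_i)=s(e_{i+1})$ (paths of length $0$ are vertices). A loop is a path of length at least $1$ with $s(\mu)=r(\mu)$; it has an exit if for some $i$ there is an edge $f\neq e_i$ with $s(f)=s(e_i)$. Let $C^*(E)$ be the graph $C^*$-algebra, i.e. the universal $C^*$-algebra generated by mutually orthogonal projections $p_v$ ($v\in E^0$) and partial isometries $s_e$ ($e\in E^1$) with $s_e^*s_e=p_{r(e)}$, and $p_v=\sum_{s(e)=v}s_es_e^*$ whenever $v$ emits at least one edge. Let $G$ be a second countable locally compact Hausdorff abelian group with dual group $\Gamma=\widehat G$, both written additively, and pairing $(t,\sigma)$. Let $\omega:E^*\to\Gamma$, $\mu\mapsto\omega_\mu$, be a labelling map, i.e. $\omega_{e_1\cdots e_n}=\omega_{e_1}+\cdots+\omega_{e_n}$ and $\omega_v=0$ for $v\in E^0$. Let $\alpha^\omega$ be the quasi-free action of $G$ on $C^*(E)$, given by $\alpha^\omega_t(s_e)=(t,\omega_e)s_e$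 and $\alpha^\omega_t(p_v)=p_v$, and let $C^*(E)\rtimes_{\alpha^\omega}G$ be the crossed product. A projection is infinite if it is Murray–von Neumann equivalent to a proper subprojection of itself; an AF algebra is a $C^*$-algebra that is the closure of the union of an increasing sequence of finite-dimensional $C^*$-subalgebras. (a) If $C^*(E)\rtimes_{\alpha^\omega}G$ embeds in an AF algebra (by an injective $*$-homomorphism), then it has no infinite projection. (b) Suppose that $C^*(E)\rtimes_{\alpha^\omega}G$ has no infinite projection. Then $\omega_\gamma+O\neq O$ for every loop $\gamma$ in $E$ which has an exit and every nonempty compact open subset $O$ of $\Gamma$. In particular, if $\Gamma$ has a nonempty compact open subset, then $\omega_\gamma\neq 0$ for every loop $\gamma$ in $E$ which has an exit. (c) If $G$ is compact, then $\Gamma$ has a nonempty compact open subset. -/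

import Mathlib

open scoped ENNReal Pointwise CompactlySupported

universe u v w

noncomputable section

namespace QuasiFree

/-! ### Bounded families of operators -/

/-- The C*-algebra of all bounded families of operators `x i : K i → K i`, with the pointwise
operations and the supremum norm. -/
def OperatorProduct {ι : Type v} (K : ι → Type w) [∀ i, NormedAddCommGroup (K i)]
    [∀ i, InnerProductSpace ℂ (K i)] [∀ i, CompleteSpace (K i)] : Type (max v w) :=
  lp (fun i => K i →L[ℂ] K i) ∞

namespace OperatorProduct

variable {ι : Type v} {K : ι → Type w} [∀ i, NormedAddCommGroup (K i)]
  [∀ i, InnerProductSpace ℂ (K i)] [∀ i, CompleteSpace (K i)]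

instance : NonUnitalCStarAlgebra (OperatorProduct K) :=
  inferInstanceAs (NonUnitalCStarAlgebra (lp (fun i => K i →L[ℂ] K i) ∞))

def component (x : OperatorProduct K) (i : ι) : K i →L[ℂ] K i := x.1 i

def mk (x : ∀ i, K i →L[ℂ] K i) (C : ℝ) (h : ∀ i, ‖x i‖ ≤ C) : OperatorProduct K :=
  ⟨x, memℓp_infty ⟨C, by rintro _ ⟨i, rfl⟩; exact h i⟩⟩

theorem component_mk (x : ∀ i, K i →L[ℂ] K i) (C : ℝ) (h : ∀ i, ‖x i‖ ≤ C) (i : ι) :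
    (mk x C h).component i = x i := rfl

theorem ext {x y : OperatorProduct K} (h : ∀ i, x.component i = y.component i) : x = y :=
  Subtype.ext (funext h)

theorem component_zero (i : ι) : (0 : OperatorProduct K).component i = 0 := rfl

theorem component_add (x y : OperatorProduct K) (i : ι) :
    (x + y).component i = x.component i + y.component i := rfl

theorem component_mul (x y : OperatorProduct K) (i : ι) :
    (x * y).component i = x.component i * y.component i := rfl

theorem component_smul (c : ℂ) (x : OperatorProduct K) (i : ι) :
    (c • x).component i = c • x.component i := rfl

theorem component_star (x : OperatorProduct K) (i : ι) :
    (star x).component i = star (x.component i) := rfl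

theorem norm_component_le (x : OperatorProduct K) (i : ι) : ‖x.component i‖ ≤ ‖x‖ :=
  lp.norm_apply_le_norm (p := ∞) (by simp) x i

theorem norm_le (x : OperatorProduct K) {C : ℝ} (hC : 0 ≤ C) (h : ∀ i, ‖x.component i‖ ≤ C) :
    ‖x‖ ≤ C :=
  lp.norm_le_of_forall_le hC h

end OperatorProduct

/-! ### Row-finite directed graphs, paths, loops and exits -/

/-- A row-finite directed graph with vertex set `V` and edge set `Edge`: every vertex emits only
finitely many edges. -/
structure RowFiniteGraph (V Edge : Type u) where
  source : Edge → V
  range : Edge → V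
  rowFinite : ∀ v : V, {e : Edge | source e = v}.Finite

namespace RowFiniteGraph

variable {V Edge : Type u}

/-- The finite set of edges emitted by a vertex. -/
def emitted (E : RowFiniteGraph V Edge) (v : V) : Finset Edge := (E.rowFinite v).toFinset

/-- `E.IsPathFrom v [e₁, …, eₙ]`: the source of `e₁` is `v` and `r(eᵢ) = s(eᵢ₊₁)` for `i < n`
(no condition if the list is empty). -/
def IsPathFrom (E : RowFiniteGraph V Edge) : V → List Edge → Prop
  | _, [] => True
  | v, e :: l => E.source e = v ∧ IsPathFrom E (E.range e) l

/-- The range of a path starting at a vertex (which is the vertex itself for length `0`). -/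
def endOf (E : RowFiniteGraph V Edge) : V → List Edge → V
  | v, [] => v
  | _, e :: l => endOf E (E.range e) l

/-- Finite paths: the set `E*` of the graph. A path of length `0` is a vertex. -/
@[ext]
structure Path (E : RowFiniteGraph V Edge) where
  source : V
  edges : List Edge
  isPath : E.IsPathFrom source edges

namespace Path

variable {E : RowFiniteGraph V Edge}

def range (μ : E.Path) : V := E.endOf μ.source μ.edges

def length (μ : E.Path) : ℕ := μ.edges.length

def IsLoop (μ : E.Path) : Prop := 1 ≤ μ.length ∧ μ.source = μ.range

/-- A path `e₁ ⋯ eₙ` has an exit if, for some `i`, the source of `eᵢ` emits an edge other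
than `eᵢ`. -/
def HasExit (μ : E.Path) : Prop := ∃ e ∈ μ.edges, ∃ f : Edge, E.source f = E.source e ∧ f ≠ e

end Path

/-- An edge, seen as a path of length one. -/
def edgePath (E : RowFiniteGraph V Edge) (e : Edge) : E.Path := ⟨E.source e, [e], rfl, trivial⟩

/-- A labelling map `E* → Γ` (with `Γ` written multiplicatively): the label of a path is the
product of the labels of its edges, and the label of a vertex is the unit. -/
structure LabellingMap (E : RowFiniteGraph V Edge) (Γ : Type w) [CommGroup Γ] where
  toFun : E.Path → Γ
  map_path : ∀ μ : E.Path, toFun μ = (μ.edges.map fun e => toFun (E.edgePath e)).prod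

instance (E : RowFiniteGraph V Edge) (Γ : Type w) [CommGroup Γ] :
    CoeFun (E.LabellingMap Γ) (fun _ => E.Path → Γ) := ⟨LabellingMap.toFun⟩

/-! ### Cuntz-Krieger families and the graph C*-algebra -/

/-- A Cuntz-Krieger `E`-family in a C*-algebra. -/
structure CuntzKriegerFamily (E : RowFiniteGraph V Edge) (B : Type w)
    [NonUnitalCStarAlgebra B] where
  P : V → B
  S : Edge → B
  isStarProjection : ∀ v, IsStarProjection (P v)
  orthogonal : ∀ v w, v ≠ w → P v * P w = 0
  partialIsometry : ∀ e, S e * star (S e) * S e = S e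
  star_mul_self : ∀ e, star (S e) * S e = P (E.range e)
  sum_emitted : ∀ v, (∃ e, E.source e = v) → P v = ∑ e ∈ E.emitted v, S e * star (S e)

namespace CuntzKriegerFamily

variable {E : RowFiniteGraph V Edge} {B : Type w} [NonUnitalCStarAlgebra B]

theorem norm_P_le (F : CuntzKriegerFamily E B) (v : V) : ‖F.P v‖ ≤ 1 := by
  have h := CStarRing.norm_star_mul_self (x := F.P v)
  rw [(F.isStarProjection v).isSelfAdjoint.star_eq, (F.isStarProjection v).isIdempotentElem.eq] at h
  by_contra hlt
  push Not at hlt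
  nlinarith

theorem norm_S_le (F : CuntzKriegerFamily E B) (e : Edge) : ‖F.S e‖ ≤ 1 := by
  have h := CStarRing.norm_star_mul_self (x := F.S e)
  rw [F.star_mul_self] at h
  have h2 := F.norm_P_le (E.range e)
  by_contra hlt
  push Not at hlt
  nlinarith

/-- Multiply each partial isometry of a family by a scalar of modulus one. -/
def twist (z : Edge → Circle) (F : CuntzKriegerFamily E B) : CuntzKriegerFamily E B where
  P := F.P
  S e := (z e : ℂ) • F.S e
  isStarProjection := F.isStarProjection
  orthogonal := F.orthogonal
  partialIsometry e := by
    have hz : (z e : ℂ) * (starRingEnd ℂ) (z e : ℂ) = 1 := by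
      rw [Complex.mul_conj, Circle.normSq_coe, Complex.ofReal_one]
    rw [star_smul, smul_mul_smul_comm, RCLike.star_def, hz, one_smul, mul_smul_comm,
      F.partialIsometry]
  star_mul_self e := by
    have hz : (starRingEnd ℂ) (z e : ℂ) * (z e : ℂ) = 1 := by
      rw [mul_comm, Complex.mul_conj, Circle.normSq_coe, Complex.ofReal_one]
    rw [star_smul, smul_mul_smul_comm, RCLike.star_def, hz, one_smul, F.star_mul_self]
  sum_emitted v hv := by
    rw [F.sum_emitted v hv]
    refine Finset.sum_congr rfl fun e _ => ?_
    have hz : (z e : ℂ) * (starRingEnd ℂ) (z e : ℂ) = 1 := by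
      rw [Complex.mul_conj, Circle.normSq_coe, Complex.ofReal_one]
    rw [star_smul, smul_mul_smul_comm, RCLike.star_def, hz, one_smul]

theorem twist_one (F : CuntzKriegerFamily E B) : F.twist 1 = F := by
  cases F; simp [twist]

theorem twist_twist (z y : Edge → Circle) (F : CuntzKriegerFamily E B) :
    (F.twist z).twist y = F.twist (z * y) := by
  cases F
  simp only [twist, Pi.mul_apply, Circle.coe_mul, mk.injEq, true_and]
  funext e
  rw [smul_smul, mul_comm]

end CuntzKriegerFamily

/-- A Cuntz-Krieger `E`-family of operators on a Hilbert space. -/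
structure CKRep (E : RowFiniteGraph V Edge) where
  K : Type u
  [normedAddCommGroup : NormedAddCommGroup K]
  [innerProductSpace : InnerProductSpace ℂ K]
  [completeSpace : CompleteSpace K]
  fam : CuntzKriegerFamily E (K →L[ℂ] K)

attribute [instance] CKRep.normedAddCommGroup CKRep.innerProductSpace CKRep.completeSpace

/-- The C*-algebra of bounded families of operators, indexed by all Cuntz-Krieger `E`-families
of operators on Hilbert spaces. -/
abbrev BigAlgebra (E : RowFiniteGraph V Edge) : Type (u + 1) :=
  OperatorProduct fun i : CKRep E => i.K

def bigP (E : RowFiniteGraph V Edge) (v : V) : BigAlgebra E :=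
  .mk (fun i => i.fam.P v) 1 fun i => i.fam.norm_P_le v

def bigS (E : RowFiniteGraph V Edge) (e : Edge) : BigAlgebra E :=
  .mk (fun i => i.fam.S e) 1 fun i => i.fam.norm_S_le e

/-- The graph C*-algebra as a subalgebra: the C*-subalgebra generated by the universal
Cuntz-Krieger family. -/
def graphSubalgebra (E : RowFiniteGraph V Edge) : NonUnitalStarSubalgebra ℂ (BigAlgebra E) :=
  (NonUnitalStarAlgebra.adjoin ℂ (Set.range E.bigP ∪ Set.range E.bigS)).topologicalClosure

/-- The graph C*-algebra `C*(E)`, the universal C*-algebra of a Cuntz-Krieger `E`-family: it is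
generated by the family `GraphAlgebra.p`, `GraphAlgebra.s`, and every Cuntz-Krieger family of
operators on a Hilbert space is the image of this family under a representation, namely
the projection to a component. -/
def GraphAlgebra (E : RowFiniteGraph V Edge) : Type (u + 1) := E.graphSubalgebra

instance (E : RowFiniteGraph V Edge) : NonUnitalCStarAlgebra E.GraphAlgebra :=
  NonUnitalStarSubalgebra.nonUnitalCStarAlgebra E.graphSubalgebra
    (h_closed := NonUnitalStarSubalgebra.isClosed_topologicalClosure _)

namespace GraphAlgebra

variable {E : RowFiniteGraph V Edge}

theorem bigP_mem (v : V) : E.bigP v ∈ E.graphSubalgebra :=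
  NonUnitalStarSubalgebra.le_topologicalClosure _
    (NonUnitalStarAlgebra.subset_adjoin ℂ _ (Or.inl ⟨v, rfl⟩))

theorem bigS_mem (e : Edge) : E.bigS e ∈ E.graphSubalgebra :=
  NonUnitalStarSubalgebra.le_topologicalClosure _
    (NonUnitalStarAlgebra.subset_adjoin ℂ _ (Or.inr ⟨e, rfl⟩))

/-- The generating projections `p_v`. -/
def p (E : RowFiniteGraph V Edge) (v : V) : E.GraphAlgebra := ⟨E.bigP v, bigP_mem v⟩

/-- The generating partial isometries `s_e`. -/
def s (E : RowFiniteGraph V Edge) (e : Edge) : E.GraphAlgebra := ⟨E.bigS e, bigS_mem e⟩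

/-- The representation of `C*(E)` given by a Cuntz-Krieger family of operators. -/
def rep (i : CKRep E) : E.GraphAlgebra →⋆ₙₐ[ℂ] (i.K →L[ℂ] i.K) where
  toFun x := OperatorProduct.component x.1 i
  map_smul' _ _ := rfl
  map_zero' := rfl
  map_add' _ _ := rfl
  map_mul' _ _ := rfl
  map_star' _ := rfl

theorem rep_p (i : CKRep E) (v : V) : rep i (p E v) = i.fam.P v := rfl

theorem rep_s (i : CKRep E) (e : Edge) : rep i (s E e) = i.fam.S e := rfl

end GraphAlgebra

/-! ### The automorphisms `s_e ↦ z_e s_e`, `p_v ↦ p_v` -/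

/-- Twist all Cuntz-Krieger families at once: an endomorphism of the big algebra. -/
def bigTwist (E : RowFiniteGraph V Edge) (z : Edge → Circle) :
    BigAlgebra E →⋆ₙₐ[ℂ] BigAlgebra E where
  toFun x := .mk (fun i => x.component (⟨i.K, i.fam.twist z⟩ : CKRep E)) ‖x‖ fun i =>
    x.norm_component_le (⟨i.K, i.fam.twist z⟩ : CKRep E)
  map_smul' _ _ := rfl
  map_zero' := rfl
  map_add' _ _ := rfl
  map_mul' _ _ := rfl
  map_star' _ := rfl

theorem bigTwist_bigP (E : RowFiniteGraph V Edge) (z : Edge → Circle) (v : V) :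
    E.bigTwist z (E.bigP v) = E.bigP v := rfl

theorem bigTwist_bigS (E : RowFiniteGraph V Edge) (z : Edge → Circle) (e : Edge) :
    E.bigTwist z (E.bigS e) = (z e : ℂ) • E.bigS e := rfl

theorem bigTwist_congr {E : RowFiniteGraph V Edge} (x : BigAlgebra E) (i : CKRep E)
    {F F' : CuntzKriegerFamily E (i.K →L[ℂ] i.K)} (h : F = F') :
    (x.component (⟨i.K, F⟩ : CKRep E) : i.K →L[ℂ] i.K) =
      x.component (⟨i.K, F'⟩ : CKRep E) := by
  subst h; rfl

theorem bigTwist_one (E : RowFiniteGraph V Edge) (x : BigAlgebra E) : E.bigTwist 1 x = x := by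
  refine OperatorProduct.ext fun i => ?_
  exact bigTwist_congr x i i.fam.twist_one

theorem bigTwist_mul (E : RowFiniteGraph V Edge) (z y : Edge → Circle) (x : BigAlgebra E) :
    E.bigTwist (z * y) x = E.bigTwist z (E.bigTwist y x) := by
  refine OperatorProduct.ext fun i => ?_
  exact bigTwist_congr x i (i.fam.twist_twist z y).symm

theorem norm_bigTwist_le (E : RowFiniteGraph V Edge) (z : Edge → Circle) (x : BigAlgebra E) :
    ‖E.bigTwist z x‖ ≤ ‖x‖ :=
  OperatorProduct.norm_le _ (norm_nonneg _) fun i =>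
    x.norm_component_le (⟨i.K, i.fam.twist z⟩ : CKRep E)

theorem continuous_bigTwist (E : RowFiniteGraph V Edge) (z : Edge → Circle) :
    Continuous (E.bigTwist z) :=
  AddMonoidHomClass.continuous_of_bound (E.bigTwist z) 1 fun x => by
    simpa using E.norm_bigTwist_le z x

theorem bigTwist_mem (E : RowFiniteGraph V Edge) (z : Edge → Circle) {x : BigAlgebra E}
    (hx : x ∈ E.graphSubalgebra) : E.bigTwist z x ∈ E.graphSubalgebra := by
  have h : E.graphSubalgebra ≤ E.graphSubalgebra.comap (E.bigTwist z) := by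
    refine NonUnitalStarSubalgebra.topologicalClosure_minimal _ ?_ ?_
    · refine NonUnitalStarAlgebra.adjoin_le ?_
      rintro _ (⟨v, rfl⟩ | ⟨e, rfl⟩)
      · exact GraphAlgebra.bigP_mem v
      · exact SMulMemClass.smul_mem (z e : ℂ) (GraphAlgebra.bigS_mem e)
    · exact (NonUnitalStarSubalgebra.isClosed_topologicalClosure _).preimage
        (E.continuous_bigTwist z)
  exact h hx

/-- The automorphism of `C*(E)` with `s_e ↦ z_e s_e` and `p_v ↦ p_v`. -/
def twistAut (E : RowFiniteGraph V Edge) (z : Edge → Circle) :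
    E.GraphAlgebra ≃⋆ₐ[ℂ] E.GraphAlgebra where
  toFun x := ⟨E.bigTwist z x.1, E.bigTwist_mem z x.2⟩
  invFun x := ⟨E.bigTwist z⁻¹ x.1, E.bigTwist_mem z⁻¹ x.2⟩
  left_inv x := Subtype.ext <| by
    change E.bigTwist z⁻¹ (E.bigTwist z x.1) = x.1
    rw [← bigTwist_mul, inv_mul_cancel, bigTwist_one]
  right_inv x := Subtype.ext <| by
    change E.bigTwist z (E.bigTwist z⁻¹ x.1) = x.1
    rw [← bigTwist_mul, mul_inv_cancel, bigTwist_one]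
  map_mul' _ _ := rfl
  map_add' _ _ := rfl
  map_star' _ := rfl
  map_smul' _ _ := rfl

end RowFiniteGraph

/-! ### C*-dynamical systems and crossed products -/

/-- A C*-dynamical system: an action of `G` on `A` by automorphisms which is continuous for the
topology of pointwise norm convergence. -/
structure CStarDynamicalSystem (A : Type v) [NonUnitalCStarAlgebra A] (G : Type w) [Group G]
    [TopologicalSpace G] where
  action : G →* (A ≃⋆ₐ[ℂ] A)
  continuous_action : ∀ a : A, Continuous fun t : G => action t a

namespace CStarDynamicalSystem

variable {A : Type v} [NonUnitalCStarAlgebra A] {G : Type w} [Group G] [TopologicalSpace G]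

/-- A covariant representation of a C*-dynamical system on a Hilbert space `K`: a
representation `π` of `A` and a strongly continuous unitary representation `U` of `G` with
`π(α_t(a)) = U_t π(a) U_t*`. -/
structure CovariantRep (α : CStarDynamicalSystem A G) where
  K : Type (max v w)
  [normedAddCommGroup : NormedAddCommGroup K]
  [innerProductSpace : InnerProductSpace ℂ K]
  [completeSpace : CompleteSpace K]
  π : A →⋆ₙₐ[ℂ] (K →L[ℂ] K)
  U : G →* unitary (K →L[ℂ] K)
  continuous_U : ∀ ξ : K, Continuous fun t : G => (U t : K →L[ℂ] K) ξ
  covariant : ∀ (t : G) (a : A),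
    π (α.action t a) = (U t : K →L[ℂ] K) * π a * star (U t : K →L[ℂ] K)

attribute [instance] CovariantRep.normedAddCommGroup CovariantRep.innerProductSpace
  CovariantRep.completeSpace

section Integrated

variable {α : CStarDynamicalSystem A G}

namespace CovariantRep

theorem continuous_integrand (ρ : α.CovariantRep) (f : C_c(G, A)) (ξ : ρ.K) :
    Continuous fun t : G => ρ.π (f t) ((ρ.U t : ρ.K →L[ℂ] ρ.K) ξ) :=
  ((AddMonoidHomClass.continuous_of_bound ρ.π 1 fun a => by
    simpa using NonUnitalStarAlgHom.norm_apply_le ρ.π a).comp f.continuous).clm_apply (ρ.continuous_U ξ)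

theorem hasCompactSupport_integrand (ρ : α.CovariantRep) (f : C_c(G, A)) (ξ : ρ.K) :
    HasCompactSupport fun t : G => ρ.π (f t) ((ρ.U t : ρ.K →L[ℂ] ρ.K) ξ) :=
  f.hasCompactSupport.mono fun t ht h0 => ht (by
    change f t = 0 at h0
    simp [h0])

variable [IsTopologicalGroup G] [LocallyCompactSpace G] [MeasurableSpace G] [BorelSpace G]

theorem integrable_integrand (ρ : α.CovariantRep) (f : C_c(G, A)) (ξ : ρ.K) :
    MeasureTheory.Integrable (fun t : G => ρ.π (f t) ((ρ.U t : ρ.K →L[ℂ] ρ.K) ξ))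
      MeasureTheory.Measure.haar :=
  (ρ.continuous_integrand f ξ).integrable_of_hasCompactSupport
    (ρ.hasCompactSupport_integrand f ξ)

theorem norm_integral_le (ρ : α.CovariantRep) (f : C_c(G, A)) (ξ : ρ.K) :
    ‖∫ t : G, ρ.π (f t) ((ρ.U t : ρ.K →L[ℂ] ρ.K) ξ) ∂MeasureTheory.Measure.haar‖ ≤
      (∫ t : G, ‖f t‖ ∂MeasureTheory.Measure.haar) * ‖ξ‖ := by
  have hf : MeasureTheory.Integrable (fun t : G => ‖f t‖) MeasureTheory.Measure.haar :=
    (f.continuous.integrable_of_hasCompactSupport f.hasCompactSupport).norm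
  rw [← MeasureTheory.integral_mul_const]
  refine MeasureTheory.norm_integral_le_of_norm_le (hf.mul_const _) (.of_forall fun t => ?_)
  refine (ContinuousLinearMap.le_opNorm _ _).trans ?_
  have h1 : ‖ρ.π (f t)‖ ≤ ‖f t‖ := NonUnitalStarAlgHom.norm_apply_le ρ.π (f t)
  have h2 : ‖(ρ.U t : ρ.K →L[ℂ] ρ.K) ξ‖ = ‖ξ‖ := by
    exact ContinuousLinearMap.norm_map_of_mem_unitary (ρ.U t).2 ξ
  rw [h2]
  gcongr

/-- The integrated form `π ⋊ U` of a covariant representation on `C_c(G, A)`: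
`(π ⋊ U)(f) = ∫ π(f(t)) U_t dt`, the integral being taken in the strong sense with respect to
Haar measure. -/
def integratedForm (ρ : α.CovariantRep) (f : C_c(G, A)) : ρ.K →L[ℂ] ρ.K :=
  LinearMap.mkContinuous
    { toFun := fun ξ => ∫ t : G, ρ.π (f t) ((ρ.U t : ρ.K →L[ℂ] ρ.K) ξ)
        ∂MeasureTheory.Measure.haar
      map_add' := fun ξ η => by
        simp only [map_add]
        exact MeasureTheory.integral_add (ρ.integrable_integrand f ξ) (ρ.integrable_integrand f η)
      map_smul' := fun c ξ => by
        simp only [map_smul, RingHom.id_apply]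
        exact MeasureTheory.integral_smul c _ }
    (∫ t : G, ‖f t‖ ∂MeasureTheory.Measure.haar) (ρ.norm_integral_le f)

theorem norm_integratedForm_le (ρ : α.CovariantRep) (f : C_c(G, A)) :
    ‖ρ.integratedForm f‖ ≤ ∫ t : G, ‖f t‖ ∂MeasureTheory.Measure.haar :=
  LinearMap.mkContinuous_norm_le _ (MeasureTheory.integral_nonneg fun _ => norm_nonneg _) _

end CovariantRep

variable [IsTopologicalGroup G] [LocallyCompactSpace G] [MeasurableSpace G] [BorelSpace G]

/-- An element of `C_c(G, A)` in the universal covariant representation; its norm is the supremum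
of the norms of `(π ⋊ U)(f)` over all covariant representations `(π, U)`. -/
def universalForm (α : CStarDynamicalSystem A G) (f : C_c(G, A)) :
    OperatorProduct fun ρ : α.CovariantRep => ρ.K :=
  .mk (fun ρ => ρ.integratedForm f) (∫ t : G, ‖f t‖ ∂MeasureTheory.Measure.haar)
    fun ρ => ρ.norm_integratedForm_le f

def crossedSubalgebra (α : CStarDynamicalSystem A G) :
    NonUnitalStarSubalgebra ℂ (OperatorProduct fun ρ : α.CovariantRep => ρ.K) :=
  (NonUnitalStarAlgebra.adjoin ℂ (Set.range α.universalForm)).topologicalClosure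

/-- The (full) crossed product `A ⋊_α G`: the completion of `C_c(G, A)` in the norm
`‖f‖ = sup ‖(π ⋊ U)(f)‖`, the supremum over all covariant representations `(π, U)`, realized as
the closure of the image of `C_c(G, A)` in the universal covariant representation (the image is
already a *-subalgebra, as integrated forms turn convolution into the product). -/
def CrossedProduct (α : CStarDynamicalSystem A G) : Type (max (v + 1) (w + 1)) :=
  α.crossedSubalgebra

instance (α : CStarDynamicalSystem A G) : NonUnitalCStarAlgebra α.CrossedProduct :=
  NonUnitalStarSubalgebra.nonUnitalCStarAlgebra α.crossedSubalgebra
    (h_closed := NonUnitalStarSubalgebra.isClosed_topologicalClosure _)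

end Integrated

end CStarDynamicalSystem

/-! ### The quasi-free action -/

namespace RowFiniteGraph

variable {V Edge : Type u} {G : Type w} [CommGroup G] [TopologicalSpace G]

/-- The scalars `(t, ω_e)`. -/
def LabellingMap.scalar {E : RowFiniteGraph V Edge} (ω : E.LabellingMap (PontryaginDual G))
    (t : G) (e : Edge) : Circle := ω (E.edgePath e) t

theorem continuous_bigTwist_scalar {E : RowFiniteGraph V Edge}
    (ω : E.LabellingMap (PontryaginDual G)) {x : BigAlgebra E} (hx : x ∈ E.graphSubalgebra) :
    Continuous fun t : G => E.bigTwist (ω.scalar t) x := by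
  rw [Metric.continuous_iff']
  intro t₀ ε hε
  have hx' : x ∈ closure
      (NonUnitalStarAlgebra.adjoin ℂ (Set.range E.bigP ∪ Set.range E.bigS) :
        Set (BigAlgebra E)) := hx
  obtain ⟨y, hy, hxy⟩ := Metric.mem_closure_iff.1 hx' (ε / 3) (by positivity)
  have hcont : Continuous fun t : G => E.bigTwist (ω.scalar t) y := by
    refine NonUnitalStarAlgebra.adjoin_induction ℂ
      (p := fun y _ => Continuous fun t : G => E.bigTwist (ω.scalar t) y)
      ?_ ?_ ?_ ?_ ?_ ?_ (ha := hy)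
    · rintro _ (⟨v, rfl⟩ | ⟨e, rfl⟩)
      · simp only [bigTwist_bigP]; exact continuous_const
      · simp only [bigTwist_bigS]
        exact (continuous_subtype_val.comp
          (map_continuous (ω (E.edgePath e)))).smul continuous_const
    · intro a b _ _ ha hb; simp only [map_add]; exact ha.add hb
    · simp only [map_zero]; exact continuous_const
    · intro a b _ _ ha hb; simp only [map_mul]; exact ha.mul hb
    · intro c a _ ha; simp only [map_smul]; exact ha.const_smul c
    · intro a _ ha; simp only [map_star]; exact ha.star
  have hd : ∀ t : G, dist (E.bigTwist (ω.scalar t) x) (E.bigTwist (ω.scalar t) y) < ε / 3 := by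
    intro t
    rw [dist_eq_norm, ← map_sub]
    rw [dist_eq_norm] at hxy
    exact (E.norm_bigTwist_le _ _).trans_lt hxy
  filter_upwards [(Metric.continuous_iff'.1 hcont) t₀ (ε / 3) (by positivity)] with t ht
  have h1 := hd t
  have h2 := hd t₀
  rw [dist_comm] at h2
  have h3 := dist_triangle4 (E.bigTwist (ω.scalar t) x) (E.bigTwist (ω.scalar t) y)
    (E.bigTwist (ω.scalar t₀) y) (E.bigTwist (ω.scalar t₀) x)
  linarith

/-- The quasi-free action of `G` on `C*(E)` defined by a labelling map `ω : E* → Ĝ`: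
`t` acts by `s_e ↦ (t, ω_e) s_e` and `p_v ↦ p_v`. -/
def quasiFreeAction (E : RowFiniteGraph V Edge) (ω : E.LabellingMap (PontryaginDual G)) :
    CStarDynamicalSystem E.GraphAlgebra G where
  action :=
    { toFun := fun t => E.twistAut (ω.scalar t)
      map_one' := by
        have h : ω.scalar (1 : G) = 1 := funext fun e => map_one (ω (E.edgePath e))
        refine StarAlgEquiv.ext fun x => Subtype.ext ?_
        change E.bigTwist (ω.scalar 1) x.1 = x.1
        rw [h, bigTwist_one]
      map_mul' := fun t t' => by
        have h : ω.scalar (t * t') = ω.scalar t * ω.scalar t' :=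
          funext fun e => map_mul (ω (E.edgePath e)) t t'
        refine StarAlgEquiv.ext fun x => Subtype.ext ?_
        change E.bigTwist (ω.scalar (t * t')) x.1 =
          E.bigTwist (ω.scalar t) (E.bigTwist (ω.scalar t') x.1)
        rw [h, bigTwist_mul] }
  continuous_action x := (continuous_bigTwist_scalar ω x.2).subtype_mk _

theorem quasiFreeAction_s (E : RowFiniteGraph V Edge) (ω : E.LabellingMap (PontryaginDual G))
    (t : G) (e : Edge) :
    (E.quasiFreeAction ω).action t (GraphAlgebra.s E e) =
      ((ω (E.edgePath e) t : Circle) : ℂ) • GraphAlgebra.s E e := rfl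

theorem quasiFreeAction_p (E : RowFiniteGraph V Edge) (ω : E.LabellingMap (PontryaginDual G))
    (t : G) (v : V) :
    (E.quasiFreeAction ω).action t (GraphAlgebra.p E v) = GraphAlgebra.p E v := rfl

end RowFiniteGraph

/-! ### Infinite projections and AF algebras -/

/-- A projection `p` is infinite if it is Murray-von Neumann equivalent to a proper
subprojection of itself: `p = x*x` and `xx* < p` for some `x`. -/
def IsInfiniteProjection {B : Type v} [NonUnitalCStarAlgebra B] (p : B) : Prop :=
  IsStarProjection p ∧ ∃ x : B, star x * x = p ∧ IsStarProjection (x * star x) ∧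
    p * (x * star x) = x * star x ∧ x * star x ≠ p

def HasNoInfiniteProjection (B : Type v) [NonUnitalCStarAlgebra B] : Prop :=
  ∀ p : B, ¬ IsInfiniteProjection p

/-- An AF algebra: the closure of the union of an increasing sequence of finite-dimensional
C*-subalgebras. -/
def IsAFAlgebra (D : Type v) [NonUnitalCStarAlgebra D] : Prop :=
  ∃ F : ℕ → NonUnitalStarSubalgebra ℂ D, Monotone F ∧ (∀ n, FiniteDimensional ℂ (F n)) ∧
    Dense (⋃ n, (F n : Set D))

/-- `B` embeds in `D`: there is an injective *-homomorphism from `B` to `D`. -/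
def EmbedsIn (B : Type v) (D : Type w) [NonUnitalCStarAlgebra B] [NonUnitalCStarAlgebra D] :
    Prop :=
  ∃ φ : B →⋆ₙₐ[ℂ] D, Function.Injective φ

end QuasiFree

end

/-! For the first claim, infinite projections survive injective *-homomorphisms, so it suffices that
an AF algebra has none. If `x*x = q` and `xx* ≤ q`, then `x + (1 - q)` is an isometry in the
unitization. It is close to an element of the unitization of a finite-dimensional subalgebra, where
injective left multiplication is surjective. Hence the isometry is unitary and `xx* = q`
(`IsAFAlgebra.mul_star_self_eq_one`, `IsAFAlgebra.hasNoInfiniteProjection`).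

For the second, suppose a loop `γ` at `v` has an exit and its label fixes a nonempty compact open
set `O` of characters. Let `S` be the partial isometry of `γ`, so `S*S = p_v`, and let `P` be the
spectral projection of `O` for the unitaries `U_t` of the universal covariant representation. Since
`S` is an eigenvector of the action with character `ω γ`, conjugation shifts spectral sets by `ω γ`,
and `P` commutes with `S`. Then `x = SP` lies in the crossed product, with `x*x = p_v P` and `xx* =
SS*P ≤ p_v P` (`exists_isInfiniteProjection`).

Two points carry the weight. The first is the existence of `P`
(`ConvolutionSystem.exists_spectral_projection`, `CStarDynamicalSystem.exists_projection`). The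
operators `∫ g(t) U_t dt` generate a commutative C*-algebra, each of whose nonzero characters
determines an element of the dual group. Compactness and openness of `O` make its preimage clopen in
the Gelfand spectrum, so its indicator is the Gelfand transform of a projection.

The second is properness. An exit yields a path `m` from `v` with `S* S_m = 0`. A vector `η` in the
range of `S_m` on which `U` acts by a character in `O` is fixed by `p_v P` and killed by `SS*P`.
Such a vector exists because a Cuntz-Krieger family on an `ℓ²` space graded by the free abelian
group on the edges makes every vertex projection nonzero and every quasi-free action diagonal
(`gradedFamily`, `exists_eigenvector`). -/

namespace QuasiFree

/-! ### AF algebras have no infinite projections -/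

section AF

variable {D : Type w} [NonUnitalCStarAlgebra D]

/-- In the unitization of an AF algebra every isometry is unitary: it is close to an element of a
finite-dimensional subalgebra, which is left invertible and therefore invertible. -/
theorem IsAFAlgebra.mul_star_self_eq_one (hD : IsAFAlgebra D) {y : Unitization ℂ D}
    (hy : star y * y = 1) : y * star y = 1 := by
  obtain ⟨F, -, hfin, hdense⟩ := hD
  have hny : ‖star y‖ ≤ 1 := by
    rw [norm_star]
    have h := CStarRing.norm_star_mul_self (x := y)
    rw [hy] at h
    have h1 : ‖(1 : Unitization ℂ D)‖ ≤ 1 := by simp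
    by_contra hlt
    push Not at hlt
    nlinarith
  obtain ⟨_, hmem, hdist⟩ := Metric.mem_closure_iff.1 (hdense y.snd) 1 one_pos
  obtain ⟨n, hn⟩ := Set.mem_iUnion.1 hmem
  rename_i d
  let ι : Unitization ℂ (F n) →ₐ[ℂ] Unitization ℂ D :=
    Unitization.lift ((Unitization.inrNonUnitalStarAlgHom ℂ D).toNonUnitalAlgHom.comp
      (NonUnitalStarSubalgebraClass.subtype (F n)).toNonUnitalAlgHom)
  have hι : ∀ z, ι z = Unitization.inl z.fst + Unitization.inr (z.snd : D) := fun z => by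
    simp [ι, Unitization.algebraMap_eq_inl]
  have hι_inj : Function.Injective ι := fun z z' h => by
    rw [hι, hι] at h
    have h1 := congrArg (fun u : Unitization ℂ D => u.fst) h
    have h2 := congrArg (fun u : Unitization ℂ D => u.snd) h
    simp at h1 h2
    exact Unitization.ext h1 h2
  have : FiniteDimensional ℂ (F n) := hfin n
  have : FiniteDimensional ℂ (Unitization ℂ (F n)) :=
    Module.Finite.equiv (Unitization.linearEquiv ℂ ℂ (F n)).symm
  -- Keeping the scalar part of `y` exactly puts the error in `D`, where the unitization norm is the
  -- original norm.
  let z : Unitization ℂ (F n) := Unitization.inl y.fst + Unitization.inr ⟨d, hn⟩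
  have hz : ‖ι z - y‖ < 1 := by
    have : ι z - y = Unitization.inr (d - y.snd) := by
      rw [hι]
      refine Unitization.ext ?_ ?_ <;> simp [z, sub_eq_add_neg]
    rw [this, Unitization.norm_inr, ← dist_eq_norm, dist_comm]
    exact hdist
  have hunit : IsUnit (star y * ι z) := by
    have h : star y * ι z = 1 - (star y * (y - ι z)) := by rw [mul_sub, hy]; abel
    rw [h]
    refine isUnit_one_sub_of_norm_lt_one ((norm_mul_le _ _).trans_lt ?_)
    rw [norm_sub_rev] at hz
    nlinarith [norm_nonneg (y - ι z)]
  -- `star y * ι z` is within distance one of the identity, so `z` is left cancellable; finite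
  -- dimension turns this into a right inverse of `z`.
  have hinj : Function.Injective (LinearMap.mulLeft ℂ z) := by
    rw [injective_iff_map_eq_zero]
    intro a ha
    have ha' : z * a = 0 := ha
    refine hι_inj ?_
    rw [map_zero, ← hunit.mul_right_eq_zero, mul_assoc, ← map_mul, ha', map_zero, mul_zero]
  obtain ⟨a, ha⟩ := LinearMap.surjective_of_injective hinj 1
  have hright : ι z * ι a = 1 := by
    rw [← map_mul, ← map_one ι]; exact congrArg ι ha
  obtain ⟨c, hc⟩ := hunit
  -- The right inverse of `ι z` makes the left inverse of `star y` explicit. As `y` is a right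
  -- inverse of `star y`, the two coincide.
  have hl : (ι z * ↑c⁻¹) * star y = 1 := by
    have h1 : (ι z * ↑c⁻¹) * star y * ι z = ι z := by
      rw [mul_assoc, ← hc, mul_assoc, Units.inv_mul, mul_one]
    calc (ι z * ↑c⁻¹) * star y = (ι z * ↑c⁻¹) * star y * ι z * ι a := by
          rw [mul_assoc _ (ι z), hright, mul_one]
      _ = 1 := by rw [h1, hright]
  have : ι z * ↑c⁻¹ = y := by
    calc ι z * ↑c⁻¹ = ι z * ↑c⁻¹ * (star y * y) := by rw [hy, mul_one]
      _ = y := by rw [← mul_assoc, hl, one_mul]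
  rwa [this] at hl

/-- The partial isometry `x` inside the corner of `q` is completed by `1 - q` to an isometry `y` of
the unitization. Unitarity of `y` reads `xx* + (1 - q) = 1`. -/
theorem IsAFAlgebra.hasNoInfiniteProjection (hD : IsAFAlgebra D) : HasNoInfiniteProjection D := by
  rintro q ⟨hq, x, hx, -, hle, hne⟩
  have hqs : star q = q := hq.isSelfAdjoint.star_eq
  have hqq : q * q = q := hq.isIdempotentElem.eq
  have hxq : x * q = x := by
    have : star (x * q - x) * (x * q - x) = 0 := by
      have e : star (x * q - x) * (x * q - x) =
        star q * (star x * x) * q - star q * (star x * x) - (star x * x) * q + star x * x := by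
        simp only [star_sub, star_mul]; noncomm_ring
      rw [e, hx, hqs, hqq, hqq]; abel
    exact sub_eq_zero.1 (CStarRing.star_mul_self_eq_zero_iff _ |>.1 this)
  have hqx : q * x = x := by
    calc q * x = q * (x * (star x * x)) := by rw [hx, hxq]
      _ = (q * (x * star x)) * x := by noncomm_ring
      _ = x := by rw [hle, mul_assoc, hx, hxq]
  have hxsq : star x * q = star x := by
    have := congrArg star hqx
    rwa [star_mul, hqs] at this
  have hqxs : q * star x = star x := by
    have := congrArg star hxq
    rwa [star_mul, hqs] at this
  let y : Unitization ℂ D := Unitization.inr x + (1 - Unitization.inr q)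
  have hys : star y = Unitization.inr (star x) + (1 - Unitization.inr q) := by
    simp [y, ← Unitization.inr_star, hqs]
  have h1 : star y * y = 1 := by
    rw [hys]
    simp only [y, add_mul, mul_add, sub_mul, mul_sub, one_mul, mul_one, ← Unitization.inr_mul,
      hx, hxsq, hqx, hqq]
    abel
  have h2 := hD.mul_star_self_eq_one h1
  rw [hys] at h2
  simp only [y, add_mul, mul_add, sub_mul, mul_sub, one_mul, mul_one, ← Unitization.inr_mul,
      hxq, hqxs, hqq] at h2
  refine hne (Unitization.inr_injective (R := ℂ) ?_)
  rw [← sub_eq_zero, ← sub_eq_zero.2 h2]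
  abel

theorem EmbedsIn.hasNoInfiniteProjection {B : Type v} [NonUnitalCStarAlgebra B]
    (h : EmbedsIn B D) (hD : HasNoInfiniteProjection D) : HasNoInfiniteProjection B := by
  obtain ⟨φ, hφ⟩ := h
  rintro q ⟨hq, x, hx, hxx, hle, hne⟩
  refine hD (φ q) ⟨hq.map φ, φ x, ?_, ?_, ?_, ?_⟩
  · rw [← map_star, ← map_mul, hx]
  · rw [← map_star, ← map_mul]; exact hxx.map φ
  · rw [← map_star, ← map_mul, ← map_mul, hle]
  · rw [← map_star, ← map_mul]; exact hφ.ne hne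

end AF

end QuasiFree

namespace QuasiFree

noncomputable section

/-! ### Fourier transforms on compact sets of characters -/

section DualGroup

open MeasureTheory

variable {G : Type v} [CommGroup G] [TopologicalSpace G] [IsTopologicalGroup G]
  [LocallyCompactSpace G]

theorem continuous_circle_coe : Continuous fun z : Circle => (z : ℂ) := continuous_subtype_val

theorem continuous_dual_apply {G : Type v} [CommGroup G] [TopologicalSpace G]
    [LocallyCompactSpace G] : Continuous fun x : PontryaginDual G × G => (x.1 x.2 : Circle) :=
  have : ContinuousEval (PontryaginDual G) G Circle :=
    inferInstanceAs (ContinuousEval (G →ₜ* Circle) G Circle)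
  continuous_eval

variable [MeasurableSpace G] [BorelSpace G]

theorem integrable_mul_dual (g : C_c(G, ℂ)) (ψ : PontryaginDual G) :
    Integrable (fun t : G => g t * (ψ t : ℂ)) Measure.haar :=
  (g.continuous.mul (continuous_circle_coe.comp (map_continuous ψ))).integrable_of_hasCompactSupport
    g.hasCompactSupport.mul_right

/-- A compact set of characters is equicontinuous at the identity, hence there is a function whose
Fourier transform is bounded away from zero on it. -/
theorem exists_norm_fourier_ge {O : Set (PontryaginDual G)} (hO : IsCompact O) :
    ∃ g : C_c(G, ℂ), ∃ c : ℝ, 0 < c ∧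
      ∀ ψ ∈ O, c ≤ ‖∫ t, g t * (ψ t : ℂ) ∂(Measure.haar : Measure G)‖ := by
  have hN : ∀ᶠ t in nhds (1 : G), ∀ ψ ∈ O, ‖(ψ t : ℂ) - 1‖ < 1 / 2 := by
    refine hO.eventually_forall_of_forall_eventually fun ψ _ => ?_
    have hc : Continuous fun x : G × PontryaginDual G => ‖((x.2 x.1 : Circle) : ℂ) - 1‖ :=
      ((continuous_circle_coe.comp (continuous_dual_apply.comp continuous_swap)).sub
        continuous_const).norm
    refine hc.continuousAt.eventually_lt continuousAt_const ?_
    simp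
  obtain ⟨N, hNsub, hNopen, h1N⟩ := eventually_nhds_iff.1 hN
  -- A bump function supported where every character of `O` is within `1/2` of `1`: replacing the
  -- character by `1` changes the integral by at most half of `∫ f`.
  obtain ⟨f, hf1, hf0, hfc, hf01⟩ := exists_continuous_one_zero_of_isCompact
    (isCompact_singleton (x := (1 : G))) hNopen.isClosed_compl (by simpa using h1N)
  let g : C_c(G, ℂ) := ⟨⟨fun t => (f t : ℂ), by fun_prop⟩,
    hfc.comp_left (g := fun x : ℝ => (x : ℂ)) Complex.ofReal_zero⟩
  have hg : ∀ t, g t = (f t : ℂ) := fun _ => rfl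
  have hfint : Integrable f (Measure.haar : Measure G) :=
    f.continuous.integrable_of_hasCompactSupport hfc
  have hpos : 0 < ∫ t, f t ∂(Measure.haar : Measure G) :=
    f.continuous.integral_pos_of_hasCompactSupport_nonneg_nonzero hfc (fun t => (hf01 t).1)
      (x := 1) (by rw [hf1 rfl]; simp)
  refine ⟨g, (∫ t, f t ∂Measure.haar) / 2, half_pos hpos, fun ψ hψ => ?_⟩
  have hg1 : ∫ t, g t ∂(Measure.haar : Measure G) = ((∫ t, f t ∂Measure.haar : ℝ) : ℂ) :=
    integral_ofReal
  have hdiff : ‖(∫ t, g t ∂(Measure.haar : Measure G)) - ∫ t, g t * (ψ t : ℂ) ∂Measure.haar‖ ≤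
      (∫ t, f t ∂Measure.haar) / 2 := by
    have hgint : Integrable (fun t => g t) (Measure.haar : Measure G) :=
      g.continuous.integrable_of_hasCompactSupport g.hasCompactSupport
    rw [← integral_sub hgint (integrable_mul_dual g ψ), ← integral_div]
    refine norm_integral_le_of_norm_le (hfint.div_const 2) (.of_forall fun t => ?_)
    rw [← mul_one_sub, norm_mul, norm_sub_rev, hg, Complex.norm_real, Real.norm_of_nonneg (hf01 t).1]
    by_cases ht : t ∈ N
    · have := hNsub t ht ψ hψ
      have := (hf01 t).1
      nlinarith
    · have : f t = 0 := hf0 ht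
      simp [this]
  have h := norm_sub_norm_le (∫ t, g t ∂(Measure.haar : Measure G))
    (∫ t, g t * (ψ t : ℂ) ∂Measure.haar)
  rw [hg1, Complex.norm_real, Real.norm_of_nonneg hpos.le, ← hg1] at h
  linarith

end DualGroup

/-! ### Commutative C*-algebras with translations -/

open MeasureTheory WeakDual

/-- A commutative C*-algebra with translation operators and convolution operators, modelled on the
C*-algebra of a locally compact abelian group. -/
structure ConvolutionSystem (G : Type v) [CommGroup G] [TopologicalSpace G] [IsTopologicalGroup G]
    [LocallyCompactSpace G] [MeasurableSpace G] [BorelSpace G]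
    (B : Type w) [NonUnitalCommCStarAlgebra B] where
  T : G → B → B
  T_mul_left : ∀ t b c, T t b * c = T t (b * c)
  T_mul : ∀ s t b, T (s * t) b = T s (T t b)
  star_T_mul : ∀ t b, star (T t b) * T t b = star b * b
  continuous_T : ∀ b, Continuous fun t => T t b
  conv : C_c(G, ℂ) → B
  conv_mul : ∀ g b, conv g * b = ∫ t, g t • T t b ∂Measure.haar

namespace ConvolutionSystem

variable {G : Type v} [CommGroup G] [TopologicalSpace G] [IsTopologicalGroup G]
  [LocallyCompactSpace G] [MeasurableSpace G] [BorelSpace G]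
  {B : Type w} [NonUnitalCommCStarAlgebra B] (C : ConvolutionSystem G B)

/-- This makes the ratio `φ (T t b) / φ b` independent of `b`; that ratio will be the character of
`G` attached to `φ`. -/
theorem map_T_mul (φ : B →ₙₐ[ℂ] ℂ) (t : G) (b c : B) : φ (C.T t b) * φ c = φ (C.T t c) * φ b := by
  rw [← map_mul, ← map_mul, C.T_mul_left, C.T_mul_left, mul_comm]

/-- A character of `B` as a character of the unitization. -/
def extend (φ : B →ₙₐ[ℂ] ℂ) : characterSpace ℂ (Unitization ℂ B) :=
  CharacterSpace.equivAlgHom.symm (Unitization.lift φ)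

theorem extend_inr (φ : B →ₙₐ[ℂ] ℂ) (b : B) : extend φ (b : Unitization ℂ B) = φ b := by
  simp [extend]

/-- The restriction of a character of the unitization. -/
def restrict (φ : characterSpace ℂ (Unitization ℂ B)) : B →ₙₐ[ℂ] ℂ :=
  (CharacterSpace.toNonUnitalAlgHom φ).comp
    (Unitization.inrNonUnitalStarAlgHom ℂ B).toNonUnitalAlgHom

theorem restrict_apply (φ : characterSpace ℂ (Unitization ℂ B)) (b : B) :
    restrict φ b = φ (b : Unitization ℂ B) := rfl

theorem restrict_extend (φ : B →ₙₐ[ℂ] ℂ) : restrict (extend φ) = φ :=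
  NonUnitalAlgHom.ext fun b => extend_inr φ b

/-- Characters of the unitization preserve the star, so `|φ b|²` depends only on `star b * b`, which
translations leave unchanged. Hence the ratio above has modulus one. -/
theorem norm_map_T (φ : B →ₙₐ[ℂ] ℂ) (t : G) (b : B) : ‖φ (C.T t b)‖ = ‖φ b‖ := by
  have hstar : ∀ x : B, φ (star x * x) = ((‖φ x‖ ^ 2 : ℝ) : ℂ) := fun x => by
    rw [← extend_inr φ, ← extend_inr φ, Unitization.inr_mul, Unitization.inr_star, map_mul, map_star,
      RCLike.star_def, Complex.conj_mul']
    simp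
  have h := hstar (C.T t b)
  rw [C.star_T_mul, hstar] at h
  have := Complex.ofReal_injective h
  exact ((sq_eq_sq₀ (norm_nonneg _) (norm_nonneg _)).1 this).symm

/-- Joint continuity comes from the Gelfand transform being isometric: `t ↦ T t b` is norm
continuous into functions on a compact space. -/
theorem continuous_map_T (b : B) : Continuous
    fun x : characterSpace ℂ (Unitization ℂ B) × G => x.1 (C.T x.2 b : Unitization ℂ B) := by
  have h : Continuous fun t : G => gelfandTransform ℂ (Unitization ℂ B) (C.T t b) :=
    (gelfandTransform_isometry _).continuous.comp
      ((Unitization.isometry_inr (𝕜 := ℂ)).continuous.comp (C.continuous_T b))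
  exact (h.comp continuous_snd).eval continuous_fst

/-- The element of the dual group determined by a character of `B`. -/
def dualOf (φ : characterSpace ℂ (Unitization ℂ B)) (b : B) (hb : φ (b : Unitization ℂ B) ≠ 0) :
    PontryaginDual G :=
  { toFun := fun t => ⟨restrict φ (C.T t b) / restrict φ b, by
      refine mem_sphere_zero_iff_norm.2 ?_
      rw [norm_div, C.norm_map_T, div_self (norm_ne_zero_iff.2 (show restrict φ b ≠ 0 from hb))]⟩
    map_one' := by
      refine Circle.ext ?_
      change restrict φ (C.T 1 b) / restrict φ b = 1
      -- That `T 1` is the identity is not among the axioms. It is idempotent, and `φ` does not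
      -- vanish on `T 1 b`, which suffices.
      have h := C.map_T_mul (restrict φ) 1 b (C.T 1 b)
      rw [← C.T_mul, one_mul] at h
      have h0 : restrict φ (C.T 1 b) ≠ 0 := by
        rw [← norm_ne_zero_iff, C.norm_map_T]; exact norm_ne_zero_iff.2 hb
      rw [mul_left_cancel₀ h0 h]
      exact div_self hb
    map_mul' := fun s t => by
      refine Circle.ext ?_
      change restrict φ (C.T (s * t) b) / restrict φ b =
        restrict φ (C.T s b) / restrict φ b * (restrict φ (C.T t b) / restrict φ b)
      have hb' : restrict φ b ≠ 0 := hb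
      have h := C.map_T_mul (restrict φ) s (C.T t b) b
      rw [← C.T_mul] at h
      field_simp
      linear_combination h
    continuous_toFun := by
      refine Continuous.subtype_mk (Continuous.div_const ?_ _) _
      exact (C.continuous_map_T b).comp (Continuous.prodMk_right φ) }

theorem dualOf_apply (φ : characterSpace ℂ (Unitization ℂ B)) (b : B)
    (hb : φ (b : Unitization ℂ B) ≠ 0) (t : G) (c : B) :
    restrict φ (C.T t c) = (C.dualOf φ b hb t : ℂ) * restrict φ c := by
  change _ = restrict φ (C.T t b) / restrict φ b * restrict φ c
  have hb' : restrict φ b ≠ 0 := hb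
  field_simp
  exact C.map_T_mul _ _ _ _

theorem exists_dual (φ : B →ₙₐ[ℂ] ℂ) (hφ : φ ≠ 0) :
    ∃ ψ : PontryaginDual G, ∀ t b, φ (C.T t b) = (ψ t : ℂ) * φ b := by
  obtain ⟨b, hb⟩ := DFunLike.ne_iff.1 hφ
  have hb' : extend φ (b : Unitization ℂ B) ≠ 0 := by rwa [extend_inr]
  refine ⟨C.dualOf (extend φ) b hb', fun t c => ?_⟩
  have := C.dualOf_apply (extend φ) b hb' t c
  rwa [restrict_extend] at this

theorem dual_unique {φ : B →ₙₐ[ℂ] ℂ} {ψ ψ' : PontryaginDual G} {b : B} (hb : φ b ≠ 0)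
    (h : ∀ t c, φ (C.T t c) = (ψ t : ℂ) * φ c) (h' : ∀ t c, φ (C.T t c) = (ψ' t : ℂ) * φ c) :
    ψ = ψ' :=
  PontryaginDual.ext fun t => Circle.ext <| mul_right_cancel₀ hb ((h t b).symm.trans (h' t b))

theorem continuous_dualOf (b : B) : Continuous
    fun φ : {φ : characterSpace ℂ (Unitization ℂ B) // φ (b : Unitization ℂ B) ≠ 0} =>
      C.dualOf φ.1 b φ.2 := by
  refine ContinuousMonoidHom.continuous_of_continuous_uncurry _ ?_
  refine Continuous.subtype_mk (f := fun x :
    {φ : characterSpace ℂ (Unitization ℂ B) // φ (b : Unitization ℂ B) ≠ 0} × G =>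
      restrict x.1.1 (C.T x.2 b) / restrict x.1.1 b) ?_ _
  refine Continuous.div ?_ ?_ fun x => x.1.2
  · exact (C.continuous_map_T b).comp (continuous_subtype_val.prodMap continuous_id)
  · exact ((map_continuous (gelfandTransform ℂ (Unitization ℂ B) b)).comp
      continuous_subtype_val).comp continuous_fst

/-- On convolution operators a character is given by the Fourier transform. -/
theorem map_conv (φ : B →ₙₐ[ℂ] ℂ) (hφ : φ ≠ 0) (ψ : PontryaginDual G)
    (h : ∀ t b, φ (C.T t b) = (ψ t : ℂ) * φ b) (g : C_c(G, ℂ)) :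
    φ (C.conv g) = ∫ t, g t * (ψ t : ℂ) ∂Measure.haar := by
  obtain ⟨b, hb⟩ := DFunLike.ne_iff.1 hφ
  let L : B →L[ℂ] ℂ := ⟨(φ : B →ₗ[ℂ] ℂ), by
    have : (φ : B → ℂ) = fun b : B => extend φ (b : Unitization ℂ B) :=
      funext fun b => (extend_inr φ b).symm
    change Continuous (φ : B → ℂ)
    rw [this]
    exact (map_continuous (extend φ)).comp (Unitization.isometry_inr (𝕜 := ℂ)).continuous⟩
  have hL : ∀ b, L b = φ b := fun _ => rfl
  have hint : Integrable (fun t : G => g t • C.T t b) Measure.haar :=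
    (g.continuous.smul (C.continuous_T b)).integrable_of_hasCompactSupport
      g.hasCompactSupport.smul_right
  refine mul_right_cancel₀ hb ?_
  rw [← map_mul, C.conv_mul, ← hL, ← L.integral_comp_comm hint, ← integral_mul_const]
  refine integral_congr_ae (.of_forall fun t => ?_)
  simp only [map_smul, hL, h, smul_eq_mul]
  ring

/-- Injectivity of the Gelfand transform of the unitization. The character at infinity restricts to
the zero homomorphism, which is allowed here. -/
theorem ext_of_characters {x y : B} (h : ∀ φ : B →ₙₐ[ℂ] ℂ, φ x = φ y) : x = y := by
  refine Unitization.inr_injective (R := ℂ) ((gelfandTransform_isometry _).injective ?_)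
  exact ContinuousMap.ext fun φ => h (restrict φ)

/-- The spectral projection of a compact open set of characters. -/
theorem exists_spectral_projection {O : Set (PontryaginDual G)} (hc : IsCompact O)
    (ho : IsOpen O) : ∃ P : B, IsStarProjection P ∧
      ∀ (φ : B →ₙₐ[ℂ] ℂ) (ψ : PontryaginDual G), φ ≠ 0 →
        (∀ t b, φ (C.T t b) = (ψ t : ℂ) * φ b) → (ψ ∈ O → φ P = 1) ∧ (ψ ∉ O → φ P = 0) := by
  classical
  obtain ⟨g, c, hcpos, hg⟩ := exists_norm_fourier_ge hc
  let b : B := C.conv g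
  let X := characterSpace ℂ (Unitization ℂ B)
  -- The preimage of `O` in the spectrum, described through the single element `b`. No character
  -- over `O` is lost, since on such a character `b` takes a Fourier transform value of modulus at
  -- least `c`.
  let W : Set X := {φ | ∃ h : φ (b : Unitization ℂ B) ≠ 0, C.dualOf φ b h ∈ O}
  have hcb : Continuous fun φ : X => φ (b : Unitization ℂ B) :=
    map_continuous (gelfandTransform ℂ (Unitization ℂ B) b)
  -- `dualOf` is continuous on the open set where `b` does not vanish.
  have hopen : IsOpen W := by
    have h0 : IsOpen {φ : X | φ (b : Unitization ℂ B) ≠ 0} := isOpen_ne_fun hcb continuous_const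
    have := h0.isOpenMap_subtype_val _ (ho.preimage (C.continuous_dualOf b))
    convert this using 1
    ext φ
    simp [W]
  have hbound : ∀ φ : X, ∀ h : φ (b : Unitization ℂ B) ≠ 0, C.dualOf φ b h ∈ O →
      c ≤ ‖φ (b : Unitization ℂ B)‖ := fun φ h hO => by
    have h1 : restrict φ ≠ 0 := fun h0 => h (by
      have := DFunLike.congr_fun h0 b
      exact this)
    have := C.map_conv (restrict φ) h1 _ (C.dualOf_apply φ b h) g
    rw [← restrict_apply, this]
    exact hg _ hO
  -- Being closed where `φ b ≠ 0` would not be enough. The lower bound `c` confines `W` to the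
  -- closed set `c ≤ ‖φ b‖`, on which `dualOf` is still continuous.
  have hclosed : IsClosed W := by
    have h0 : IsClosed {φ : X | c ≤ ‖φ (b : Unitization ℂ B)‖} :=
      isClosed_le continuous_const hcb.norm
    let j : {φ : X // c ≤ ‖φ (b : Unitization ℂ B)‖} →
        {φ : X // φ (b : Unitization ℂ B) ≠ 0} := fun φ =>
      ⟨φ.1, fun h => by have := φ.2; rw [h, norm_zero] at this; linarith⟩
    have hj : Continuous j := continuous_subtype_val.subtype_mk _
    have := h0.isClosedMap_subtype_val _ (hc.isClosed.preimage ((C.continuous_dualOf b).comp hj))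
    convert this using 1
    ext φ
    simp only [W, Set.mem_ofPred_eq, Set.mem_image, Set.mem_preimage, Function.comp_apply,
      Subtype.exists, exists_and_right, exists_eq_right, j]
    exact ⟨fun ⟨h, hO⟩ => ⟨hbound φ h hO, hO⟩, fun ⟨h, hO⟩ => ⟨_, hO⟩⟩
  let f : C(X, ℂ) := ⟨W.indicator 1, continuous_one.indicator (by
    rw [IsClopen.frontier_eq ⟨hclosed, hopen⟩]; simp)⟩
  have hf : ∀ φ, f φ = W.indicator 1 φ := fun _ => rfl
  let p := (gelfandStarTransform (Unitization ℂ B)).symm f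
  have hp : ∀ φ : X, φ p = W.indicator 1 φ := fun φ => by
    rw [← hf, ← (gelfandStarTransform (Unitization ℂ B)).apply_symm_apply f]; rfl
  have hpproj : IsStarProjection p := by
    have : IsStarProjection f := by
      constructor
      · refine ContinuousMap.ext fun φ => ?_
        rw [ContinuousMap.mul_apply, hf]
        by_cases h : φ ∈ W <;> simp [h]
      · refine ContinuousMap.ext fun φ => ?_
        rw [ContinuousMap.star_apply, hf]
        by_cases h : φ ∈ W <;> simp [h]
    exact this.map (gelfandStarTransform (Unitization ℂ B)).symm
  -- The character at infinity kills `b` and so lies outside `W`; hence `p` belongs to `B` itself.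
  have hfst : p.fst = 0 := by
    have h1 : extend (0 : B →ₙₐ[ℂ] ℂ) p = p.fst := by
      simp [extend]
    rw [← h1, hp, Set.indicator_of_notMem]
    rintro ⟨h, -⟩
    exact h (by rw [extend_inr]; rfl)
  have hpinr : p = (p.snd : Unitization ℂ B) := Unitization.ext hfst rfl
  refine ⟨p.snd, ?_, fun φ ψ hφ hψ => ?_⟩
  · rw [hpinr] at hpproj
    constructor
    · exact Unitization.inr_injective (R := ℂ) (by
        simpa only [Unitization.inr_mul] using hpproj.isIdempotentElem.eq)
    · exact Unitization.inr_injective (R := ℂ) (by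
        simpa only [Unitization.inr_star] using hpproj.isSelfAdjoint.star_eq)
  · have h1 : φ p.snd = W.indicator 1 (extend φ) := by
      rw [← hp, ← extend_inr φ, ← hpinr]
    have h2 : ∀ h : extend φ (b : Unitization ℂ B) ≠ 0, C.dualOf (extend φ) b h = ψ := fun h =>
      C.dual_unique (φ := φ) (b := b) (by rwa [extend_inr] at h) (fun t c => by
        have := C.dualOf_apply (extend φ) b h t c
        rwa [restrict_extend] at this) hψ
    rw [h1]
    refine ⟨fun hO => ?_, fun hO => ?_⟩
    · rw [Set.indicator_of_mem]; · rfl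
      have h3 : extend φ (b : Unitization ℂ B) ≠ 0 := by
        rw [extend_inr, C.map_conv φ hφ ψ hψ, ← norm_pos_iff]
        exact hcpos.trans_le (hg ψ hO)
      exact ⟨h3, by rwa [h2 h3]⟩
    · rw [Set.indicator_of_notMem]
      rintro ⟨h3, h4⟩
      exact hO (by rwa [h2 h3] at h4)

end ConvolutionSystem

end

end QuasiFree

namespace QuasiFree

noncomputable section

open MeasureTheory

namespace CStarDynamicalSystem

variable {A : Type v} [NonUnitalCStarAlgebra A] {G : Type w} [CommGroup G] [TopologicalSpace G]
  {α : CStarDynamicalSystem A G}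

/-! ### Operators in the universal covariant representation -/

namespace CovariantRep

variable (ρ : α.CovariantRep)

theorem U_mul_apply (s t : G) (ξ : ρ.K) :
    (ρ.U (s * t) : ρ.K →L[ℂ] ρ.K) ξ = (ρ.U s : ρ.K →L[ℂ] ρ.K) ((ρ.U t : ρ.K →L[ℂ] ρ.K) ξ) := by
  rw [map_mul]; rfl

theorem U_one_apply (ξ : ρ.K) : (ρ.U 1 : ρ.K →L[ℂ] ρ.K) ξ = ξ := by
  rw [map_one]; rfl

theorem star_U (t : G) : star (ρ.U t : ρ.K →L[ℂ] ρ.K) = ρ.U t⁻¹ := by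
  rw [map_inv, ← Unitary.star_eq_inv]; rfl

theorem norm_U_apply (t : G) (ξ : ρ.K) : ‖(ρ.U t : ρ.K →L[ℂ] ρ.K) ξ‖ = ‖ξ‖ :=
  ContinuousLinearMap.norm_map_of_mem_unitary (ρ.U t).2 ξ

theorem inner_U_apply (t : G) (ξ η : ρ.K) :
    inner ℂ ξ ((ρ.U t : ρ.K →L[ℂ] ρ.K) η) = inner ℂ ((ρ.U t⁻¹ : ρ.K →L[ℂ] ρ.K) ξ) η := by
  rw [← ρ.star_U, ContinuousLinearMap.star_eq_adjoint, ContinuousLinearMap.adjoint_inner_left]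

/-- Covariance read for an eigenvector of the action: `π s` intertwines the unitaries up to the
character `χ`. This is the source of the shift of spectral sets. -/
theorem U_π_apply {χ : PontryaginDual G} {s : A}
    (hs : ∀ t, α.action t s = (χ t : ℂ) • s) (t : G) (ξ : ρ.K) :
    (ρ.U t : ρ.K →L[ℂ] ρ.K) (ρ.π s ξ) = (χ t : ℂ) • ρ.π s ((ρ.U t : ρ.K →L[ℂ] ρ.K) ξ) := by
  have h := ρ.covariant t s
  rw [hs, map_smul] at h
  have h' := DFunLike.congr_fun h ((ρ.U t : ρ.K →L[ℂ] ρ.K) ξ)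
  rw [smul_apply] at h'
  rw [h', mul_apply_eq_comp, mul_apply_eq_comp, ρ.star_U, ← ρ.U_mul_apply,
    inv_mul_cancel, ρ.U_one_apply]

/-- The covariant representation obtained by multiplying the unitaries by a character. -/
def twist (χ : PontryaginDual G) : α.CovariantRep where
  K := ρ.K
  π := ρ.π
  U :=
    { toFun := fun t => ⟨(χ t : ℂ) • (ρ.U t : ρ.K →L[ℂ] ρ.K), by
        have h1 : (starRingEnd ℂ) (χ t : ℂ) * (χ t : ℂ) = 1 := by
          rw [mul_comm, Complex.mul_conj, Circle.normSq_coe, Complex.ofReal_one]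
        have h2 : (χ t : ℂ) * (starRingEnd ℂ) (χ t : ℂ) = 1 := by rw [mul_comm, h1]
        constructor
        · rw [star_smul, smul_mul_smul_comm, RCLike.star_def, h1, one_smul,
            Unitary.star_mul_self_of_mem (ρ.U t).2]
        · rw [star_smul, smul_mul_smul_comm, RCLike.star_def, h2, one_smul,
            Unitary.mul_star_self_of_mem (ρ.U t).2]⟩
      map_one' := Subtype.ext (by simp)
      map_mul' := fun s t => Subtype.ext (by simp [smul_smul, mul_comm]) }
  continuous_U ξ :=
    (continuous_circle_coe.comp (map_continuous χ)).smul (ρ.continuous_U ξ)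
  covariant t a := by
    have h2 : (χ t : ℂ) * (starRingEnd ℂ) (χ t : ℂ) = 1 := by
      rw [Complex.mul_conj, Circle.normSq_coe, Complex.ofReal_one]
    change _ = ((χ t : ℂ) • (ρ.U t : ρ.K →L[ℂ] ρ.K)) * ρ.π a *
      star ((χ t : ℂ) • (ρ.U t : ρ.K →L[ℂ] ρ.K))
    rw [star_smul, smul_mul_assoc, smul_mul_smul_comm, RCLike.star_def, h2, one_smul, ρ.covariant]

end CovariantRep

variable (α) in
/-- Bounded families of operators indexed by all covariant representations. -/
abbrev UniversalFamily : Type (max (v + 1) (w + 1)) :=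
  OperatorProduct fun ρ : α.CovariantRep => ρ.K

theorem UniversalFamily.ext {x y : α.UniversalFamily}
    (h : ∀ ρ ξ, x.component ρ ξ = y.component ρ ξ) : x = y :=
  OperatorProduct.ext fun ρ => ContinuousLinearMap.ext (h ρ)

variable (α) in
def unitaryFamily (t : G) : α.UniversalFamily :=
  .mk (fun ρ => (ρ.U t : ρ.K →L[ℂ] ρ.K)) 1 fun ρ =>
    ContinuousLinearMap.opNorm_le_bound _ zero_le_one fun ξ => by rw [ρ.norm_U_apply, one_mul]

theorem unitaryFamily_mul (s t : G) :
    α.unitaryFamily (s * t) = α.unitaryFamily s * α.unitaryFamily t :=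
  UniversalFamily.ext fun ρ ξ => ρ.U_mul_apply s t ξ

theorem star_unitaryFamily (t : G) : star (α.unitaryFamily t) = α.unitaryFamily t⁻¹ :=
  OperatorProduct.ext fun ρ => ρ.star_U t

theorem unitaryFamily_one_mul (x : α.UniversalFamily) : α.unitaryFamily 1 * x = x :=
  UniversalFamily.ext fun ρ _ => ρ.U_one_apply _

theorem norm_unitaryFamily_mul_le (t : G) (x : α.UniversalFamily) :
    ‖α.unitaryFamily t * x‖ ≤ ‖x‖ :=
  OperatorProduct.norm_le _ (norm_nonneg _) fun ρ =>
    ContinuousLinearMap.opNorm_le_bound _ (norm_nonneg _) fun ξ => by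
      change ‖(ρ.U t : ρ.K →L[ℂ] ρ.K) (x.component ρ ξ)‖ ≤ _
      rw [ρ.norm_U_apply]
      exact (ContinuousLinearMap.le_opNorm _ _).trans
        (mul_le_mul_of_nonneg_right (x.norm_component_le ρ) (norm_nonneg _))

variable (α) in
/-- The representation of `A` in the universal covariant representation. -/
def representFamily : A →⋆ₙₐ[ℂ] α.UniversalFamily where
  toFun a := .mk (fun ρ => ρ.π a) ‖a‖ fun ρ => NonUnitalStarAlgHom.norm_apply_le ρ.π a
  map_smul' c a := OperatorProduct.ext fun ρ => map_smul ρ.π c a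
  map_zero' := OperatorProduct.ext fun ρ => map_zero ρ.π
  map_add' a b := OperatorProduct.ext fun ρ => map_add ρ.π a b
  map_mul' a b := OperatorProduct.ext fun ρ => map_mul ρ.π a b
  map_star' a := OperatorProduct.ext fun ρ => map_star ρ.π a

/-- The dual action of a character on families of operators. -/
def dualAction (χ : PontryaginDual G) : α.UniversalFamily →⋆ₙₐ[ℂ] α.UniversalFamily where
  -- Twisting changes the unitaries but not the Hilbert space, so reindexing the family by it is a
  -- *-homomorphism componentwise.
  toFun x := .mk (fun ρ => x.component (ρ.twist χ)) ‖x‖ fun ρ => x.norm_component_le (ρ.twist χ)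
  map_smul' _ _ := rfl
  map_zero' := rfl
  map_add' _ _ := rfl
  map_mul' _ _ := rfl
  map_star' _ := rfl

theorem norm_dualAction_le (χ : PontryaginDual G) (x : α.UniversalFamily) :
    ‖dualAction χ x‖ ≤ ‖x‖ :=
  OperatorProduct.norm_le _ (norm_nonneg _) fun ρ => x.norm_component_le (ρ.twist χ)

theorem continuous_dualAction (χ : PontryaginDual G) :
    Continuous (dualAction (α := α) χ) :=
  AddMonoidHomClass.continuous_of_bound (dualAction χ) 1 fun x => by
    simpa using norm_dualAction_le χ x

theorem dualAction_unitaryFamily (χ : PontryaginDual G) (t : G) :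
    dualAction χ (α.unitaryFamily t) = (χ t : ℂ) • α.unitaryFamily t := rfl

/-- Multiplication by a character. -/
def modulate (χ : PontryaginDual G) (g : C_c(G, ℂ)) : C_c(G, ℂ) :=
  ⟨⟨fun s => g s * (χ s : ℂ),
    g.continuous.mul (continuous_circle_coe.comp (map_continuous χ))⟩,
    g.hasCompactSupport.mul_right⟩

theorem modulate_one (g : C_c(G, ℂ)) : modulate 1 g = g := by
  ext t
  change g t * ((1 : Circle) : ℂ) = g t
  simp

theorem unitaryFamily_mul_comm (s t : G) :
    α.unitaryFamily s * α.unitaryFamily t = α.unitaryFamily t * α.unitaryFamily s := by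
  rw [← unitaryFamily_mul, mul_comm, unitaryFamily_mul]

/-! ### Integrated operators of scalar functions -/

section Convolution

variable [IsTopologicalGroup G] [LocallyCompactSpace G] [MeasurableSpace G] [BorelSpace G]

namespace CovariantRep

variable (ρ : α.CovariantRep)

theorem integrable_conv (g : C_c(G, ℂ)) (ξ : ρ.K) :
    Integrable (fun t : G => g t • (ρ.U t : ρ.K →L[ℂ] ρ.K) ξ) Measure.haar :=
  (g.continuous.smul (ρ.continuous_U ξ)).integrable_of_hasCompactSupport
    g.hasCompactSupport.smul_right

theorem norm_conv_apply_le (g : C_c(G, ℂ)) (ξ : ρ.K) :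
    ‖∫ t : G, g t • (ρ.U t : ρ.K →L[ℂ] ρ.K) ξ ∂Measure.haar‖ ≤
      (∫ t : G, ‖g t‖ ∂Measure.haar) * ‖ξ‖ := by
  have hg : Integrable (fun t : G => ‖g t‖) Measure.haar :=
    (g.continuous.integrable_of_hasCompactSupport g.hasCompactSupport).norm
  rw [← integral_mul_const]
  refine norm_integral_le_of_norm_le (hg.mul_const _) (.of_forall fun t => ?_)
  rw [norm_smul, ρ.norm_U_apply]

/-- The operator `∫ g(t) U_t dt`. -/
def conv (g : C_c(G, ℂ)) : ρ.K →L[ℂ] ρ.K :=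
  LinearMap.mkContinuous
    { toFun := fun ξ => ∫ t : G, g t • (ρ.U t : ρ.K →L[ℂ] ρ.K) ξ ∂Measure.haar
      map_add' := fun ξ η => by
        simp only [map_add, smul_add]
        exact integral_add (ρ.integrable_conv g ξ) (ρ.integrable_conv g η)
      map_smul' := fun c ξ => by
        simp only [map_smul, RingHom.id_apply]
        rw [← integral_smul]
        exact integral_congr_ae (.of_forall fun t => smul_comm _ _ _) }
    (∫ t : G, ‖g t‖ ∂Measure.haar) (ρ.norm_conv_apply_le g)

end CovariantRep

variable (α) in
/-- The operators `∫ g(t) U_t dt` in the universal covariant representation. -/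
def convFamily : C_c(G, ℂ) →ₗ[ℂ] α.UniversalFamily where
  toFun g := .mk (fun ρ => ρ.conv g) (∫ t : G, ‖g t‖ ∂Measure.haar) fun ρ =>
    LinearMap.mkContinuous_norm_le _ (integral_nonneg fun _ => norm_nonneg _) _
  map_add' g h := UniversalFamily.ext fun ρ ξ => by
    have := integral_add (ρ.integrable_conv g ξ) (ρ.integrable_conv h ξ)
    simp_rw [← add_smul] at this
    exact this
  map_smul' c g := UniversalFamily.ext fun ρ ξ => by
    have := integral_smul (μ := Measure.haar) c (fun t : G => g t • (ρ.U t : ρ.K →L[ℂ] ρ.K) ξ)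
    simp_rw [← smul_assoc] at this
    exact this

theorem convFamily_apply (g : C_c(G, ℂ)) (ρ : α.CovariantRep) (ξ : ρ.K) :
    (α.convFamily g).component ρ ξ = ∫ t : G, g t • (ρ.U t : ρ.K →L[ℂ] ρ.K) ξ ∂Measure.haar := rfl

theorem norm_convFamily_le (g : C_c(G, ℂ)) :
    ‖α.convFamily g‖ ≤ ∫ t : G, ‖g t‖ ∂Measure.haar :=
  OperatorProduct.norm_le _ (integral_nonneg fun _ => norm_nonneg _) fun ρ =>
    LinearMap.mkContinuous_norm_le _ (integral_nonneg fun _ => norm_nonneg _)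
      (ρ.norm_conv_apply_le g)

/-- Translation of a compactly supported function. -/
def translate (t : G) (g : C_c(G, ℂ)) : C_c(G, ℂ) :=
  ⟨⟨fun s => g (t⁻¹ * s), by fun_prop⟩,
    g.hasCompactSupport.comp_homeomorph (Homeomorph.mulLeft t⁻¹)⟩

/-- The involution of the group algebra. -/
def involution (g : C_c(G, ℂ)) : C_c(G, ℂ) :=
  ⟨⟨fun s => star (g s⁻¹), by fun_prop⟩,
    (g.hasCompactSupport.comp_homeomorph (Homeomorph.inv G)).comp_left (g := star) (star_zero ℂ)⟩

/-- Left invariance of Haar measure. -/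
theorem unitaryFamily_mul_convFamily (t : G) (g : C_c(G, ℂ)) :
    α.unitaryFamily t * α.convFamily g = α.convFamily (translate t g) :=
  UniversalFamily.ext fun ρ ξ => by
    change (ρ.U t : ρ.K →L[ℂ] ρ.K) (∫ s : G, g s • (ρ.U s : ρ.K →L[ℂ] ρ.K) ξ ∂Measure.haar) =
      ∫ s : G, g (t⁻¹ * s) • (ρ.U s : ρ.K →L[ℂ] ρ.K) ξ ∂Measure.haar
    rw [← ContinuousLinearMap.integral_comp_comm _ (ρ.integrable_conv g ξ),
      ← integral_mul_left_eq_self (fun s : G => g (t⁻¹ * s) • (ρ.U s : ρ.K →L[ℂ] ρ.K) ξ) t]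
    refine integral_congr_ae (.of_forall fun s => ?_)
    simp only [map_smul, inv_mul_cancel_left, ρ.U_mul_apply]

/-- What commutes with the unitaries up to a character commutes with their integrals up to the
dual action. -/
theorem convFamily_mul_of_intertwines {χ : PontryaginDual G} {x : α.UniversalFamily}
    (hx : ∀ t, α.unitaryFamily t * x = (χ t : ℂ) • (x * α.unitaryFamily t)) (g : C_c(G, ℂ)) :
    α.convFamily g * x = x * α.convFamily (modulate χ g) :=
  UniversalFamily.ext fun ρ ξ => by
    change ∫ t : G, g t • (ρ.U t : ρ.K →L[ℂ] ρ.K) (x.component ρ ξ) ∂Measure.haar =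
      x.component ρ (∫ t : G, (modulate χ g) t • (ρ.U t : ρ.K →L[ℂ] ρ.K) ξ ∂Measure.haar)
    rw [← ContinuousLinearMap.integral_comp_comm _ (ρ.integrable_conv _ ξ)]
    refine integral_congr_ae (.of_forall fun t => ?_)
    have h : (ρ.U t : ρ.K →L[ℂ] ρ.K) (x.component ρ ξ) =
        (χ t : ℂ) • x.component ρ ((ρ.U t : ρ.K →L[ℂ] ρ.K) ξ) :=
      congrArg (fun y : α.UniversalFamily => y.component ρ ξ) (hx t)
    have h2 : modulate χ g t = g t * (χ t : ℂ) := rfl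
    simp only [map_smul, h, h2, mul_smul]

theorem convFamily_mul_comm_of_commutes {x : α.UniversalFamily}
    (hx : ∀ t, α.unitaryFamily t * x = x * α.unitaryFamily t) (g : C_c(G, ℂ)) :
    α.convFamily g * x = x * α.convFamily g := by
  have := convFamily_mul_of_intertwines (χ := 1) (x := x) (fun t => by simp [hx]) g
  rwa [modulate_one] at this

theorem dualAction_convFamily (χ : PontryaginDual G) (g : C_c(G, ℂ)) :
    dualAction χ (α.convFamily g) = α.convFamily (modulate χ g) :=
  UniversalFamily.ext fun ρ ξ => by
    change ∫ t : G, g t • ((χ t : ℂ) • (ρ.U t : ρ.K →L[ℂ] ρ.K) ξ) ∂Measure.haar =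
      ∫ t : G, (g t * (χ t : ℂ)) • (ρ.U t : ρ.K →L[ℂ] ρ.K) ξ ∂Measure.haar
    simp_rw [mul_smul]

/-- Checked on inner products, using that Haar measure on an abelian group is invariant under
inversion; this is why `involution` carries no modular function. -/
theorem star_convFamily (g : C_c(G, ℂ)) :
    star (α.convFamily g) = α.convFamily (involution g) :=
  UniversalFamily.ext fun ρ ξ => by
    have hinner : ∀ (h : C_c(G, ℂ)) (η ζ : ρ.K), inner ℂ η ((α.convFamily h).component ρ ζ) =
        ∫ t : G, h t * inner ℂ η ((ρ.U t : ρ.K →L[ℂ] ρ.K) ζ) ∂Measure.haar := fun h η ζ => by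
      rw [convFamily_apply, ← integral_inner (ρ.integrable_conv h ζ)]
      simp_rw [inner_smul_right]
    refine ext_inner_left ℂ fun η => ?_
    change inner ℂ η (star ((α.convFamily g).component ρ) ξ) = _
    rw [ContinuousLinearMap.star_eq_adjoint, ContinuousLinearMap.adjoint_inner_right,
      ← inner_conj_symm, hinner, hinner, ← integral_conj, ← integral_inv_eq_self]
    refine integral_congr_ae (.of_forall fun t => ?_)
    have h2 : involution g t = star (g t⁻¹) := rfl
    simp only [map_mul, h2, RCLike.star_def]
    rw [inner_conj_symm, ρ.inner_U_apply]

/-- The operator norm is dominated by the `L¹` norm, in which translation of `g` is continuous. The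
`U_t` alone are only assumed strongly continuous. -/
theorem continuous_unitaryFamily_mul_convFamily (g : C_c(G, ℂ)) :
    Continuous fun t : G => α.unitaryFamily t * α.convFamily g := by
  refine continuous_iff_continuousAt.2 fun t₀ => ?_
  obtain ⟨N, hNc, hN⟩ := exists_compact_mem_nhds t₀
  -- For `t` in the compact neighbourhood `N`, all translates are supported in the compact set `N *
  -- tsupport g`.
  have hcont : ContinuousOn (fun t : G => ∫ s : G, ‖g (t⁻¹ * s) - g (t₀⁻¹ * s)‖ ∂Measure.haar) N := by
    refine continuousOn_integral_of_compact_support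
      (hNc.mul (g.hasCompactSupport : IsCompact (tsupport g))) ?_ ?_
    · exact Continuous.continuousOn (by fun_prop)
    · intro t s ht hs
      have h0 : ∀ t' ∈ N, g (t'⁻¹ * s) = 0 := fun t' ht' => by
        by_contra h
        exact hs (Set.mem_mul.2 ⟨t', ht', t'⁻¹ * s, subset_tsupport _ h, by simp⟩)
      rw [h0 t ht, h0 t₀ (mem_of_mem_nhds hN), sub_zero, norm_zero]
  have hlim := (hcont.continuousAt hN).tendsto
  simp only [sub_self, norm_zero, integral_zero] at hlim
  refine tendsto_iff_norm_sub_tendsto_zero.2 (squeeze_zero (fun _ => norm_nonneg _) (fun t => ?_) hlim)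
  beta_reduce
  rw [unitaryFamily_mul_convFamily, unitaryFamily_mul_convFamily, ← map_sub]
  exact norm_convFamily_le _

/-- Norm continuity of `t ↦ U_t x` turns a strong integral into a Bochner integral in the algebra,
which continuous linear maps and closed subspaces respect. -/
theorem convFamily_mul_eq_integral (g : C_c(G, ℂ)) (x : α.UniversalFamily)
    (hx : Continuous fun t : G => α.unitaryFamily t * x) :
    α.convFamily g * x = ∫ t : G, g t • (α.unitaryFamily t * x) ∂Measure.haar :=
  UniversalFamily.ext fun ρ ξ => by
    have hint : Integrable (fun t : G => g t • (α.unitaryFamily t * x)) Measure.haar :=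
      (g.continuous.smul hx).integrable_of_hasCompactSupport g.hasCompactSupport.smul_right
    let L : α.UniversalFamily →L[ℂ] ρ.K := LinearMap.mkContinuous
      { toFun := fun y => y.component ρ ξ
        map_add' := fun _ _ => rfl
        map_smul' := fun _ _ => rfl } ‖ξ‖ fun y => by
          rw [mul_comm]
          exact (ContinuousLinearMap.le_opNorm _ _).trans
            (mul_le_mul_of_nonneg_right (y.norm_component_le ρ) (norm_nonneg _))
    exact L.integral_comp_comm hint

/-- The function `t ↦ g(t) a`. -/
def tensor (g : C_c(G, ℂ)) (a : A) : C_c(G, A) :=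
  ⟨⟨fun t => g t • a, by fun_prop⟩, g.hasCompactSupport.smul_right⟩

/-- The link with the crossed product: neither factor need lie in it, but their product is the image
of an elementary tensor in `C_c(G, A)`. -/
theorem representFamily_mul_convFamily (a : A) (g : C_c(G, ℂ)) :
    α.representFamily a * α.convFamily g = α.universalForm (tensor g a) :=
  UniversalFamily.ext fun ρ ξ => by
    change ρ.π a (∫ t : G, g t • (ρ.U t : ρ.K →L[ℂ] ρ.K) ξ ∂Measure.haar) =
      ∫ t : G, ρ.π (g t • a) ((ρ.U t : ρ.K →L[ℂ] ρ.K) ξ) ∂Measure.haar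
    rw [← ContinuousLinearMap.integral_comp_comm _ (ρ.integrable_conv g ξ)]
    refine integral_congr_ae (.of_forall fun t => ?_)
    simp only [map_smul, smul_apply]

end Convolution

end CStarDynamicalSystem

end

end QuasiFree

namespace QuasiFree

noncomputable section

open MeasureTheory

namespace CStarDynamicalSystem

variable {A : Type v} [NonUnitalCStarAlgebra A] {G : Type w} [CommGroup G] [TopologicalSpace G]
  [IsTopologicalGroup G] [LocallyCompactSpace G] [MeasurableSpace G] [BorelSpace G]
  {α : CStarDynamicalSystem A G}

/-! ### The C*-algebra generated by the unitaries of the universal covariant representation -/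

variable (α) in
/-- The closure of the space of the operators `∫ g(t) U_t dt`. -/
def convSubmodule : Submodule ℂ α.UniversalFamily :=
  (LinearMap.range α.convFamily).topologicalClosure

theorem isClosed_convSubmodule : IsClosed (α.convSubmodule : Set α.UniversalFamily) :=
  Submodule.isClosed_topologicalClosure _

theorem convFamily_mem (g : C_c(G, ℂ)) : α.convFamily g ∈ α.convSubmodule :=
  Submodule.le_topologicalClosure _ ⟨g, rfl⟩

theorem convSubmodule_induction {p : α.UniversalFamily → Prop} (hc : IsClosed {x | p x})
    (h : ∀ g, p (α.convFamily g)) {x : α.UniversalFamily} (hx : x ∈ α.convSubmodule) : p x := by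
  have hx' : x ∈ closure (Set.range α.convFamily) := hx
  exact closure_minimal (t := {x | p x}) (by rintro _ ⟨g, rfl⟩; exact h g) hc hx'

theorem unitaryFamily_mul_mem (t : G) {x : α.UniversalFamily} (hx : x ∈ α.convSubmodule) :
    α.unitaryFamily t * x ∈ α.convSubmodule :=
  convSubmodule_induction (p := fun x => α.unitaryFamily t * x ∈ α.convSubmodule)
    (isClosed_convSubmodule.preimage (continuous_const_mul _)) (fun g => by
      rw [unitaryFamily_mul_convFamily]; exact convFamily_mem _) hx

theorem unitaryFamily_commutes (t : G) {x : α.UniversalFamily} (hx : x ∈ α.convSubmodule) :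
    α.unitaryFamily t * x = x * α.unitaryFamily t :=
  convSubmodule_induction (p := fun x => α.unitaryFamily t * x = x * α.unitaryFamily t)
    (isClosed_eq (continuous_const_mul _) (continuous_mul_const _))
    (fun g => (convFamily_mul_comm_of_commutes (fun s => unitaryFamily_mul_comm s t) g).symm) hx

theorem convSubmodule_commutes {x y : α.UniversalFamily} (hx : x ∈ α.convSubmodule)
    (hy : y ∈ α.convSubmodule) : x * y = y * x :=
  convSubmodule_induction (p := fun x => x * y = y * x)
    (isClosed_eq (continuous_mul_const _) (continuous_const_mul _))
    (fun g => convFamily_mul_comm_of_commutes (fun t => unitaryFamily_commutes t hy) g) hx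

theorem star_mem_convSubmodule {x : α.UniversalFamily} (hx : x ∈ α.convSubmodule) :
    star x ∈ α.convSubmodule :=
  convSubmodule_induction (p := fun x => star x ∈ α.convSubmodule)
    (isClosed_convSubmodule.preimage continuous_star) (fun g => by
      rw [star_convFamily]; exact convFamily_mem _) hx

theorem continuous_unitaryFamily_mul {x : α.UniversalFamily} (hx : x ∈ α.convSubmodule) :
    Continuous fun t : G => α.unitaryFamily t * x := by
  refine continuous_of_uniform_approx_of_continuous fun u hu => ?_
  obtain ⟨ε, hε, hεu⟩ := Metric.mem_uniformity_dist.1 hu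
  have hx' : x ∈ closure (Set.range α.convFamily) := hx
  obtain ⟨_, ⟨g, rfl⟩, hg⟩ := Metric.mem_closure_iff.1 hx' ε hε
  refine ⟨_, continuous_unitaryFamily_mul_convFamily g, fun t => hεu ?_⟩
  rw [dist_eq_norm, ← mul_sub]
  rw [dist_eq_norm] at hg
  exact (norm_unitaryFamily_mul_le _ _).trans_lt hg

theorem integral_mem_convSubmodule (f : G → α.UniversalFamily) (hf : Continuous f)
    (hfc : HasCompactSupport f) (hmem : ∀ t, f t ∈ α.convSubmodule) :
    ∫ t, f t ∂Measure.haar ∈ α.convSubmodule := by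
  have : CompleteSpace α.convSubmodule := isClosed_convSubmodule.completeSpace_coe
  let f' : G → α.convSubmodule := fun t => ⟨f t, hmem t⟩
  have hf' : Continuous f' := hf.subtype_mk _
  have hfc' : HasCompactSupport f' := hfc.mono fun t ht h0 => ht (Subtype.ext h0)
  have h := α.convSubmodule.subtypeL.integral_comp_comm
    (hf'.integrable_of_hasCompactSupport (μ := Measure.haar) hfc')
  have h' : ∫ t, f t ∂Measure.haar = α.convSubmodule.subtypeL (∫ t, f' t ∂Measure.haar) := h
  rw [h']
  exact (∫ t, f' t ∂Measure.haar : α.convSubmodule).2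

/-- A product `convFamily g * y` is a norm integral of scalar multiples of the `U_t y`, all in the
closed subspace. Convolution of functions is never needed. -/
theorem mul_mem_convSubmodule {x y : α.UniversalFamily} (hx : x ∈ α.convSubmodule)
    (hy : y ∈ α.convSubmodule) : x * y ∈ α.convSubmodule :=
  convSubmodule_induction (p := fun x => x * y ∈ α.convSubmodule)
    (isClosed_convSubmodule.preimage (continuous_mul_const _)) (fun g => by
      have hc := continuous_unitaryFamily_mul hy
      rw [convFamily_mul_eq_integral g y hc]
      exact integral_mem_convSubmodule _ (g.continuous.smul hc) g.hasCompactSupport.smul_right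
        fun t => Submodule.smul_mem _ _ (unitaryFamily_mul_mem t hy)) hx

variable (α) in
/-- The image of the group C*-algebra in the universal covariant representation. -/
def convSubalgebra : NonUnitalStarSubalgebra ℂ α.UniversalFamily :=
  { α.convSubmodule with
    mul_mem' := mul_mem_convSubmodule
    star_mem' := star_mem_convSubmodule }

instance : NonUnitalCommCStarAlgebra α.convSubalgebra :=
  { NonUnitalStarSubalgebra.nonUnitalCStarAlgebra α.convSubalgebra
      (h_closed := isClosed_convSubmodule) with
    mul_comm := fun x y => Subtype.ext (convSubmodule_commutes x.2 y.2) }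

variable (α) in
-- Translations are multiplication by the `U_t`, so the Gelfand argument for abstract systems
-- applies to the universal covariant representation.
def convolutionSystem : ConvolutionSystem G α.convSubalgebra where
  T t b := ⟨α.unitaryFamily t * b, unitaryFamily_mul_mem t b.2⟩
  T_mul_left t b c := Subtype.ext (mul_assoc _ _ _)
  T_mul s t b := Subtype.ext (by
    change α.unitaryFamily (s * t) * (b : α.UniversalFamily) =
      α.unitaryFamily s * (α.unitaryFamily t * b)
    rw [unitaryFamily_mul, mul_assoc])
  star_T_mul t b := Subtype.ext (by
    change star (α.unitaryFamily t * (b : α.UniversalFamily)) * (α.unitaryFamily t * b) =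
      star (b : α.UniversalFamily) * b
    rw [star_mul, star_unitaryFamily, mul_assoc, ← mul_assoc (α.unitaryFamily t⁻¹),
      ← unitaryFamily_mul, inv_mul_cancel, unitaryFamily_one_mul])
  continuous_T b := (continuous_unitaryFamily_mul b.2).subtype_mk _
  conv g := ⟨α.convFamily g, convFamily_mem g⟩
  conv_mul g b := Subtype.ext (by
    have hc := continuous_unitaryFamily_mul b.2
    change α.convFamily g * (b : α.UniversalFamily) = _
    rw [convFamily_mul_eq_integral g _ hc]
    have hc' : Continuous fun t : G => (⟨α.unitaryFamily t * b, unitaryFamily_mul_mem t b.2⟩ :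
      α.convSubalgebra) := hc.subtype_mk _
    let L : α.convSubalgebra →L[ℂ] α.UniversalFamily :=
      ⟨NonUnitalStarSubalgebraClass.subtype α.convSubalgebra, continuous_subtype_val⟩
    exact L.integral_comp_comm ((g.continuous.smul hc').integrable_of_hasCompactSupport
      (μ := Measure.haar) g.hasCompactSupport.smul_right))

theorem dualAction_mem (χ : PontryaginDual G) {x : α.UniversalFamily}
    (hx : x ∈ α.convSubmodule) : dualAction χ x ∈ α.convSubmodule :=
  convSubmodule_induction (p := fun x => dualAction χ x ∈ α.convSubmodule)
    (isClosed_convSubmodule.preimage (continuous_dualAction χ)) (fun g => by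
      rw [dualAction_convFamily]; exact convFamily_mem _) hx

theorem dualAction_inv (χ : PontryaginDual G) {x : α.UniversalFamily}
    (hx : x ∈ α.convSubmodule) : dualAction χ (dualAction χ⁻¹ x) = x :=
  convSubmodule_induction (p := fun x => dualAction χ (dualAction χ⁻¹ x) = x)
    (isClosed_eq ((continuous_dualAction χ).comp (continuous_dualAction χ⁻¹)) continuous_id)
    (fun g => by
      rw [dualAction_convFamily, dualAction_convFamily]
      congr 1
      ext t
      change g t * ((χ t)⁻¹ : Circle) * (χ t : ℂ) = g t
      rw [mul_assoc, ← Circle.coe_mul, inv_mul_cancel, Circle.coe_one, mul_one]) hx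

/-- The intertwining relation for the integrated operators, passed to limits. Moving `x` past `s`
costs the dual action of `χ`, so `x` commutes with `s` whenever the dual action fixes `x`. -/
theorem mul_representFamily {χ : PontryaginDual G} {s : A}
    (hs : ∀ t, α.action t s = (χ t : ℂ) • s) {x : α.UniversalFamily} (hx : x ∈ α.convSubmodule) :
    x * α.representFamily s = α.representFamily s * dualAction χ x :=
  convSubmodule_induction
    (p := fun x => x * α.representFamily s = α.representFamily s * dualAction χ x)
    (isClosed_eq (continuous_mul_const _)
      ((continuous_const_mul _).comp (continuous_dualAction χ)))
    (fun g => by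
      rw [dualAction_convFamily]
      exact convFamily_mul_of_intertwines (χ := χ) (x := α.representFamily s)
        (fun t => UniversalFamily.ext fun ρ ξ => ρ.U_π_apply hs t ξ) g) hx

theorem representFamily_mul_mem (a : A) {x : α.UniversalFamily} (hx : x ∈ α.convSubmodule) :
    α.representFamily a * x ∈ α.crossedSubalgebra :=
  convSubmodule_induction (p := fun x => α.representFamily a * x ∈ α.crossedSubalgebra)
    ((NonUnitalStarSubalgebra.isClosed_topologicalClosure _).preimage (continuous_const_mul _))
    (fun g => by
      rw [representFamily_mul_convFamily]
      exact NonUnitalStarSubalgebra.le_topologicalClosure _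
        (NonUnitalStarAlgebra.subset_adjoin ℂ _ ⟨_, rfl⟩)) hx

/-- A common eigenvector of the unitaries is an eigenvector of the algebra they generate. -/
theorem exists_eigencharacter (ρ : α.CovariantRep) {θ : PontryaginDual G} {ξ : ρ.K} (hξ : ξ ≠ 0)
    (h : ∀ t, (ρ.U t : ρ.K →L[ℂ] ρ.K) ξ = (θ t : ℂ) • ξ) :
    ∃ φ : α.convSubalgebra →ₙₐ[ℂ] ℂ, φ ≠ 0 ∧
      (∀ t b, φ (α.convolutionSystem.T t b) = (θ t : ℂ) * φ b) ∧
      ∀ b : α.convSubalgebra, (b : α.UniversalFamily).component ρ ξ = φ b • ξ := by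
  have hconv : ∀ g, (α.convFamily g).component ρ ξ =
      (∫ t, g t * (θ t : ℂ) ∂Measure.haar) • ξ := fun g => by
    rw [convFamily_apply, ← integral_smul_const]
    simp_rw [h, mul_smul]
  -- The line spanned by `ξ` is closed, so it suffices to treat the generators, which act by Fourier
  -- transform values.
  have heig : ∀ b : α.convSubalgebra, (b : α.UniversalFamily).component ρ ξ ∈ ℂ ∙ ξ := fun b => by
    have hcont : Continuous fun x : α.UniversalFamily => x.component ρ ξ := by
      have h1 : Continuous fun x : α.UniversalFamily => x.component ρ := by
        refine continuous_iff_continuousAt.2 fun x => tendsto_iff_norm_sub_tendsto_zero.2 ?_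
        refine squeeze_zero (fun _ => norm_nonneg _) (fun y => ?_)
          (tendsto_iff_norm_sub_tendsto_zero.1 (Filter.tendsto_id (x := nhds x)))
        exact (y - x).norm_component_le ρ
      exact h1.clm_apply continuous_const
    refine convSubmodule_induction (p := fun x => x.component ρ ξ ∈ ℂ ∙ ξ)
      ((Submodule.closed_of_finiteDimensional _).preimage hcont) (fun g => ?_) b.2
    rw [hconv]
    exact Submodule.smul_mem _ _ (Submodule.mem_span_singleton_self ξ)
  choose f hf using fun b => Submodule.mem_span_singleton.1 (heig b)
  have hinj : Function.Injective fun c : ℂ => c • ξ := smul_left_injective ℂ hξ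
  let φ : α.convSubalgebra →ₙₐ[ℂ] ℂ :=
    { toFun := f
      map_smul' := fun c b => hinj (by
        change f (c • b) • ξ = (c * f b) • ξ
        rw [hf, mul_smul, hf]; rfl)
      map_zero' := hinj (by
        change f 0 • ξ = (0 : ℂ) • ξ
        rw [hf, zero_smul]; rfl)
      map_add' := fun b c => hinj (by
        change f (b + c) • ξ = (f b + f c) • ξ
        rw [hf, add_smul, hf, hf]; rfl)
      map_mul' := fun b c => hinj (by
        change f (b * c) • ξ = (f b * f c) • ξ
        rw [hf, mul_comm, mul_smul, hf, ← map_smul, hf]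
        rfl) }
  refine ⟨φ, ?_, fun t b => hinj ?_, fun b => (hf b).symm⟩
  -- Nonvanishing of the character: some `g` has nonzero Fourier transform at `θ`.
  · obtain ⟨g, c, hc, hg⟩ := exists_norm_fourier_ge (isCompact_singleton (x := θ))
    intro h0
    have h1 : f ⟨α.convFamily g, convFamily_mem g⟩ = 0 := DFunLike.congr_fun h0 _
    have h2 := hf ⟨α.convFamily g, convFamily_mem g⟩
    rw [h1, zero_smul] at h2
    have h3 := hconv g
    rw [← h2, eq_comm, smul_eq_zero_iff_left hξ] at h3
    have h4 := hg θ rfl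
    rw [h3, norm_zero] at h4
    linarith
  · change f _ • ξ = ((θ t : ℂ) * f b) • ξ
    rw [hf, mul_comm, mul_smul, ← h, ← map_smul, hf]
    rfl

/-- The spectral projection of a compact open set of characters in the universal covariant
representation. -/
theorem exists_projection {O : Set (PontryaginDual G)} (hc : IsCompact O) (ho : IsOpen O) :
    ∃ P : α.UniversalFamily, IsStarProjection P ∧
      (∀ a, α.representFamily a * P ∈ α.crossedSubalgebra) ∧
      (∀ (χ : PontryaginDual G) (s : A), χ • O = O → (∀ t, α.action t s = (χ t : ℂ) • s) →
        P * α.representFamily s = α.representFamily s * P) ∧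
      ∀ (ρ : α.CovariantRep) (θ : PontryaginDual G) (ξ : ρ.K), θ ∈ O →
        (∀ t, (ρ.U t : ρ.K →L[ℂ] ρ.K) ξ = (θ t : ℂ) • ξ) → P.component ρ ξ = ξ := by
  obtain ⟨P, hP, hspec⟩ := α.convolutionSystem.exists_spectral_projection hc ho
  refine ⟨P, ?_, fun a => representFamily_mul_mem a P.2, fun χ s hχ hs => ?_, fun ρ θ ξ hθ h => ?_⟩
  · exact ⟨congrArg Subtype.val hP.isIdempotentElem.eq, congrArg Subtype.val hP.isSelfAdjoint.star_eq⟩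
  · rw [mul_representFamily hs P.2]
    let β : α.convSubalgebra →ₙₐ[ℂ] α.convSubalgebra :=
      { toFun := fun b => ⟨dualAction χ b, dualAction_mem χ b.2⟩
        map_smul' := fun c b => Subtype.ext (map_smul (dualAction χ) c (b : α.UniversalFamily))
        map_zero' := Subtype.ext (map_zero (dualAction χ))
        map_add' := fun b c => Subtype.ext (map_add (dualAction χ) (b : α.UniversalFamily) c)
        map_mul' := fun b c => Subtype.ext (map_mul (dualAction χ) (b : α.UniversalFamily) c) }
    -- Composing a character over `ψ` with the dual action gives one over `χ * ψ`. As `χ • O = O`,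
    -- both see `P` with the same value, and characters separate points.
    have hβ : β P = P := by
      refine ConvolutionSystem.ext_of_characters fun φ => ?_
      by_cases hφ : φ = 0
      · simp [hφ]
      obtain ⟨ψ, hψ⟩ := α.convolutionSystem.exists_dual φ hφ
      -- `β` is surjective, by the dual action of `χ⁻¹`.
      have h0 : φ.comp β ≠ 0 := fun h0 => hφ (NonUnitalAlgHom.ext fun b => by
        have h1 : β ⟨dualAction χ⁻¹ b, dualAction_mem χ⁻¹ b.2⟩ = b :=
          Subtype.ext (dualAction_inv χ b.2)
        rw [← h1]
        exact DFunLike.congr_fun h0 _)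
      have hψ' : ∀ t b, (φ.comp β) (α.convolutionSystem.T t b) =
          ((χ * ψ) t : ℂ) * (φ.comp β) b := fun t b => by
        have h1 : β (α.convolutionSystem.T t b) =
            (χ t : ℂ) • α.convolutionSystem.T t (β b) := Subtype.ext (by
          change dualAction χ (α.unitaryFamily t * (b : α.UniversalFamily)) =
            (χ t : ℂ) • (α.unitaryFamily t * dualAction χ b)
          rw [map_mul, dualAction_unitaryFamily, smul_mul_assoc])
        have h2 : ((χ * ψ) t : ℂ) = (χ t : ℂ) * (ψ t : ℂ) := rfl
        rw [NonUnitalAlgHom.comp_apply, h1, map_smul, hψ, h2, NonUnitalAlgHom.comp_apply,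
          smul_eq_mul, mul_assoc]
      have hiff : χ * ψ ∈ O ↔ ψ ∈ O := by
        conv_lhs => rw [← hχ]
        exact Set.smul_mem_smul_set_iff
      have h1 := hspec φ ψ hφ hψ
      have h2 := hspec (φ.comp β) (χ * ψ) h0 hψ'
      rw [hiff] at h2
      by_cases hO : ψ ∈ O
      · rw [h1.1 hO]; exact h2.1 hO
      · rw [h1.2 hO]; exact h2.2 hO
    rw [show dualAction χ (P : α.UniversalFamily) = P from congrArg Subtype.val hβ]
  · by_cases hξ : ξ = 0
    · simp [hξ]
    obtain ⟨φ, hφ, hT, hb⟩ := exists_eigencharacter ρ hξ h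
    rw [hb, (hspec φ θ hφ hT).1 hθ, one_smul]

end CStarDynamicalSystem

end

end QuasiFree

namespace QuasiFree

noncomputable section

namespace RowFiniteGraph

variable {V Edge : Type u} {E : RowFiniteGraph V Edge}

/-! ### Relations in the graph C*-algebra -/

namespace CuntzKriegerFamily

variable {K : Type w} [NormedAddCommGroup K] [InnerProductSpace ℂ K] [CompleteSpace K]
  (F : CuntzKriegerFamily E (K →L[ℂ] K))

/-- Range projections of edges from one vertex sum to a projection. For `ξ` in the range of `S e`,
the quantities `‖star (S g) ξ‖²` sum to at most `‖ξ‖²`, and the term of `e` already exhausts this.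
-/
theorem star_S_mul_S_of_ne {e f : Edge} (hs : E.source f = E.source e) (hne : f ≠ e) :
    star (F.S f) * F.S e = 0 := by
  classical
  refine ContinuousLinearMap.ext fun η => ?_
  let ξ := F.S e η
  have hnorm : ∀ g, RCLike.re (inner ℂ ((F.S g * star (F.S g)) ξ) ξ) = ‖star (F.S g) ξ‖ ^ 2 :=
    fun g => by
      rw [mul_apply_eq_comp, ← ContinuousLinearMap.adjoint_inner_right,
        ← ContinuousLinearMap.star_eq_adjoint, inner_self_eq_norm_sq]
  have hsum : RCLike.re (inner ℂ (F.P (E.source e) ξ) ξ) =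
      ∑ g ∈ E.emitted (E.source e), ‖star (F.S g) ξ‖ ^ 2 := by
    rw [F.sum_emitted _ ⟨e, rfl⟩, sum_apply, sum_inner, map_sum]
    exact Finset.sum_congr rfl fun g _ => hnorm g
  have hle : RCLike.re (inner ℂ (F.P (E.source e) ξ) ξ) ≤ ‖ξ‖ ^ 2 := by
    refine (re_inner_le_norm _ _).trans ?_
    rw [sq]
    gcongr
    exact ((F.P _).le_opNorm ξ).trans (by
      simpa using mul_le_mul_of_nonneg_right (F.norm_P_le (E.source e)) (norm_nonneg ξ))
  have he : ‖ξ‖ ≤ ‖star (F.S e) ξ‖ := by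
    have h1 : ξ = F.S e (star (F.S e) ξ) := (DFunLike.congr_fun (F.partialIsometry e) η).symm
    calc ‖ξ‖ = ‖F.S e (star (F.S e) ξ)‖ := by rw [← h1]
      _ ≤ 1 * ‖star (F.S e) ξ‖ := (F.S e).le_of_opNorm_le (F.norm_S_le e) _
      _ = _ := one_mul _
  have hpair : ‖star (F.S e) ξ‖ ^ 2 + ‖star (F.S f) ξ‖ ^ 2 ≤
      ∑ g ∈ E.emitted (E.source e), ‖star (F.S g) ξ‖ ^ 2 := by
    rw [← Finset.sum_pair (f := fun g => ‖star (F.S g) ξ‖ ^ 2) hne.symm]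
    refine Finset.sum_le_sum_of_subset_of_nonneg ?_ fun _ _ _ => sq_nonneg _
    intro g hg
    rcases Finset.mem_insert.1 hg with rfl | hg
    · simp [emitted]
    · rw [Finset.mem_singleton.1 hg]; simp [emitted, hs]
  have h0 : ‖star (F.S f) ξ‖ ^ 2 ≤ 0 := by
    have := pow_le_pow_left₀ (norm_nonneg _) he 2
    linarith
  exact norm_eq_zero.1 (pow_eq_zero_iff two_ne_zero |>.1 (le_antisymm h0 (sq_nonneg _)))

theorem P_source_mul_S (e : Edge) : F.P (E.source e) * F.S e = F.S e := by
  rw [F.sum_emitted _ ⟨e, rfl⟩, Finset.sum_mul, Finset.sum_eq_single e, F.partialIsometry]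
  · intro f hf hne
    rw [mul_assoc, F.star_S_mul_S_of_ne (by simpa [emitted] using hf) hne, mul_zero]
  · intro h
    simp [emitted] at h

end CuntzKriegerFamily

namespace GraphAlgebra

theorem ext_rep {x y : E.GraphAlgebra} (h : ∀ i : CKRep E, rep i x = rep i y) : x = y :=
  Subtype.ext (OperatorProduct.ext h)

theorem isStarProjection_p (v : V) : IsStarProjection (p E v) where
  isIdempotentElem := ext_rep fun i => (i.fam.isStarProjection v).isIdempotentElem
  isSelfAdjoint := ext_rep fun i => (i.fam.isStarProjection v).isSelfAdjoint

theorem star_s_mul_s (e : Edge) : star (s E e) * s E e = p E (E.range e) :=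
  ext_rep fun i => i.fam.star_mul_self e

theorem star_s_mul_s_of_ne {e f : Edge} (hs : E.source f = E.source e) (hne : f ≠ e) :
    star (s E f) * s E e = 0 :=
  ext_rep fun i => i.fam.star_S_mul_S_of_ne hs hne

theorem p_source_mul_s (e : Edge) : p E (E.source e) * s E e = s E e :=
  ext_rep fun i => i.fam.P_source_mul_S e

/-- The partial isometry of a path. -/
def pathOp (E : RowFiniteGraph V Edge) : V → List Edge → E.GraphAlgebra
  | v, [] => p E v
  | _, e :: l => s E e * pathOp E (E.range e) l

theorem p_mul_pathOp {v : V} {l : List Edge} (h : E.IsPathFrom v l) :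
    p E v * pathOp E v l = pathOp E v l := by
  cases l with
  | nil => exact (isStarProjection_p v).isIdempotentElem
  | cons e l =>
    obtain ⟨rfl, -⟩ := h
    rw [pathOp, ← mul_assoc, p_source_mul_s]

theorem star_pathOp_mul_self {v : V} {l : List Edge} (h : E.IsPathFrom v l) :
    star (pathOp E v l) * pathOp E v l = p E (E.endOf v l) := by
  induction l generalizing v with
  | nil =>
    rw [pathOp, (isStarProjection_p v).isSelfAdjoint.star_eq]
    exact (isStarProjection_p v).isIdempotentElem
  | cons e l ih =>
    rw [pathOp, star_mul, mul_assoc, ← mul_assoc (star (s E e)), star_s_mul_s, p_mul_pathOp h.2,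
      ih h.2, endOf]

/-- A path with an exit has range projection orthogonal to that of another path with the same
source. -/
theorem exists_orthogonal_path {v : V} {l : List Edge} (h : E.IsPathFrom v l) {e f : Edge}
    (he : e ∈ l) (hs : E.source f = E.source e) (hne : f ≠ e) :
    ∃ m, E.IsPathFrom v m ∧ star (pathOp E v l) * pathOp E v m = 0 := by
  induction l generalizing v with
  | nil => simp at he
  | cons d l ih =>
    obtain ⟨hd, hl⟩ := h
    -- The new path follows `l` up to the edge with the exit and then leaves by `f`.
    rcases List.mem_cons.1 he with rfl | he
    · refine ⟨[f], ⟨hs.trans hd, trivial⟩, ?_⟩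
      rw [pathOp, pathOp, star_mul, mul_assoc, ← mul_assoc (star (s E e)),
        star_s_mul_s_of_ne hs.symm hne.symm, zero_mul, mul_zero]
    · obtain ⟨m, hm, h0⟩ := ih hl he
      refine ⟨d :: m, ⟨hd, hm⟩, ?_⟩
      rw [pathOp, pathOp, star_mul, mul_assoc, ← mul_assoc (star (s E d)), star_s_mul_s,
        p_mul_pathOp hm, h0]

/-- Path operators are eigenvectors of the quasi-free action; for a path this character is its
label. -/
theorem action_pathOp {G : Type w} [CommGroup G] [TopologicalSpace G]
    (ω : E.LabellingMap (PontryaginDual G)) (t : G) (v : V) (l : List Edge) :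
    (E.quasiFreeAction ω).action t (pathOp E v l) =
      (((l.map fun e => ω (E.edgePath e)).prod t : Circle) : ℂ) • pathOp E v l := by
  induction l generalizing v with
  | nil => simp [pathOp, quasiFreeAction_p]
  | cons e l ih =>
    have h : ((((e :: l).map fun e => ω (E.edgePath e)).prod t : Circle) : ℂ) =
      (ω (E.edgePath e) t : ℂ) * ((l.map fun e => ω (E.edgePath e)).prod t : Circle) := by
      rw [List.map_cons, List.prod_cons]; rfl
    rw [pathOp, map_mul, quasiFreeAction_s, ih, smul_mul_smul_comm, h]

/-- A *-homomorphism on the graph C*-algebra is determined by its values on the generators. -/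
theorem hom_ext {B : Type w} [NonUnitalCStarAlgebra B] {φ ψ : E.GraphAlgebra →⋆ₙₐ[ℂ] B}
    (hp : ∀ v, φ (p E v) = ψ (p E v)) (hs : ∀ e, φ (s E e) = ψ (s E e)) : φ = ψ := by
  have hcont : ∀ χ : E.GraphAlgebra →⋆ₙₐ[ℂ] B, Continuous χ := fun χ =>
    AddMonoidHomClass.continuous_of_bound χ 1 fun a => by
      simpa using NonUnitalStarAlgHom.norm_apply_le χ a
  let D : NonUnitalStarSubalgebra ℂ (BigAlgebra E) :=
    NonUnitalStarAlgebra.adjoin ℂ (Set.range E.bigP ∪ Set.range E.bigS)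
  have hind : ∀ y ∈ D, ∃ z : E.GraphAlgebra, z.1 = y ∧ φ z = ψ z := fun y hy => by
    refine NonUnitalStarAlgebra.adjoin_induction ℂ
      (p := fun y _ => ∃ z : E.GraphAlgebra, z.1 = y ∧ φ z = ψ z) ?_ ?_ ?_ ?_ ?_ ?_ (ha := hy)
    · rintro _ (⟨v, rfl⟩ | ⟨e, rfl⟩)
      · exact ⟨p E v, rfl, hp v⟩
      · exact ⟨s E e, rfl, hs e⟩
    · rintro _ _ _ _ ⟨a, rfl, ha⟩ ⟨b, rfl, hb⟩
      exact ⟨a + b, rfl, by rw [map_add, map_add, ha, hb]⟩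
    · exact ⟨0, rfl, by rw [map_zero, map_zero]⟩
    · rintro _ _ _ _ ⟨a, rfl, ha⟩ ⟨b, rfl, hb⟩
      exact ⟨a * b, rfl, by rw [map_mul, map_mul, ha, hb]⟩
    · rintro c _ _ ⟨a, rfl, ha⟩
      exact ⟨c • a, rfl, by rw [map_smul, map_smul, ha]⟩
    · rintro _ _ ⟨a, rfl, ha⟩
      exact ⟨star a, rfl, by rw [map_star, map_star, ha]⟩
  have hdense : Dense {x : E.GraphAlgebra | φ x = ψ x} := by
    refine Subtype.dense_iff.2 fun x hx => ?_
    have hx' : x ∈ closure (D : Set (BigAlgebra E)) := hx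
    exact closure_mono (fun y hy => by
      obtain ⟨z, rfl, hz⟩ := hind y hy
      exact ⟨z, hz, rfl⟩) hx'
  exact DFunLike.coe_injective (Continuous.ext_on hdense (hcont φ) (hcont ψ) fun x hx => hx)

end GraphAlgebra

end RowFiniteGraph

end

end QuasiFree

namespace QuasiFree

noncomputable section

/-! ### Operators given on Hilbert bases -/

section HilbertBasis

open ContinuousLinearMap

variable {ι : Type*} {H H' : Type*} [NormedAddCommGroup H] [InnerProductSpace ℂ H]
  [NormedAddCommGroup H'] [InnerProductSpace ℂ H']

/-- The standard basis of `ℓ²(ι)`. -/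
def stdBasis (ι : Type*) : HilbertBasis ι ℂ (lp (fun _ : ι => ℂ) 2) :=
  ⟨LinearIsometryEquiv.refl ℂ _⟩

theorem hilbertBasis_ext (b : HilbertBasis ι ℂ H) {S T : H →L[ℂ] H'} (h : ∀ i, S (b i) = T (b i)) :
    S = T :=
  ContinuousLinearMap.ext_on (Submodule.dense_iff_topologicalClosure_eq_top.2 b.dense_span) (by
    rintro _ ⟨i, rfl⟩; exact h i)

variable [CompleteSpace H']

/-- The isometry sending a Hilbert basis to an orthonormal family. -/
def basisIsometry (b : HilbertBasis ι ℂ H) {v : ι → H'} (hv : Orthonormal ℂ v) : H →L[ℂ] H' :=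
  (hv.orthogonalFamily.linearIsometry.comp b.repr.toLinearIsometry).toContinuousLinearMap

theorem basisIsometry_apply (b : HilbertBasis ι ℂ H) {v : ι → H'} (hv : Orthonormal ℂ v) (i : ι) :
    basisIsometry b hv (b i) = v i := by
  classical
  change hv.orthogonalFamily.linearIsometry (b.repr (b i)) = v i
  rw [b.repr_self, OrthogonalFamily.linearIsometry_apply_single]
  simp

variable [CompleteSpace H]

theorem adjoint_basisIsometry_comp_self (b : HilbertBasis ι ℂ H) {v : ι → H'}
    (hv : Orthonormal ℂ v) : adjoint (basisIsometry b hv) ∘L basisIsometry b hv = 1 :=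
  LinearIsometry.adjoint_comp_self _

theorem adjoint_basisIsometry_apply (b : HilbertBasis ι ℂ H) {v : ι → H'}
    (hv : Orthonormal ℂ v) (i : ι) : adjoint (basisIsometry b hv) (v i) = b i := by
  have := DFunLike.congr_fun (adjoint_basisIsometry_comp_self b hv) (b i)
  rw [ContinuousLinearMap.comp_apply, basisIsometry_apply] at this
  exact this

theorem adjoint_basisIsometry_eq_zero (b : HilbertBasis ι ℂ H) {v : ι → H'}
    (hv : Orthonormal ℂ v) {x : H'} (hx : ∀ i, inner ℂ (v i) x = 0) :
    adjoint (basisIsometry b hv) x = 0 := by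
  refine (map_eq_zero_iff b.repr b.repr.injective).1 (lp.ext (funext fun i => ?_))
  rw [b.repr_apply_apply, adjoint_inner_right, basisIsometry_apply, hx]
  rfl

end HilbertBasis

namespace RowFiniteGraph

variable {V Edge : Type u} (E : RowFiniteGraph V Edge)

/-- For each vertex, a bijection between `ℕ` and pairs of an emitted edge and a natural number. -/
theorem exists_coding : ∃ c : Edge → ℕ → ℕ,
    (∀ e f k l, E.source e = E.source f → c e k = c f l → e = f ∧ k = l) ∧
      ∀ e m, ∃ f k, E.source f = E.source e ∧ c f k = m := by
  -- Row-finiteness makes the set of edges finite, hence countable, and it is nonempty, so its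
  -- product with `ℕ` is countably infinite.
  have hσ : ∀ e : Edge, Nonempty ({f : Edge // E.source f = E.source e} × ℕ ≃ ℕ) := fun e => by
    have : Finite {f : Edge // E.source f = E.source e} := E.rowFinite (E.source e)
    have : Nonempty {f : Edge // E.source f = E.source e} := ⟨⟨e, rfl⟩⟩
    exact nonempty_equiv_of_countable
  have hσ' : ∀ v : V, ∃ σ : {f : Edge // E.source f = v} × ℕ → ℕ,
      (∃ e, E.source e = v) → Function.Bijective σ := fun v => by
    by_cases h : ∃ e, E.source e = v
    · obtain ⟨e, rfl⟩ := h
      exact ⟨(hσ e).some, fun _ => (hσ e).some.bijective⟩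
    · exact ⟨fun _ => 0, fun h' => (h h').elim⟩
  choose σ hbij using hσ'
  refine ⟨fun e k => σ (E.source e) (⟨e, rfl⟩, k), fun e f k l hs h => ?_, fun e m => ?_⟩
  · have h2 : ∀ v (hf : E.source f = v), σ (E.source f) (⟨f, rfl⟩, l) = σ v (⟨f, hf⟩, l) := by
      rintro _ rfl; rfl
    beta_reduce at h
    rw [h2 _ hs.symm] at h
    have := (hbij _ ⟨e, rfl⟩).1 h
    simpa using this
  · obtain ⟨⟨⟨f, hf⟩, k⟩, h⟩ := (hbij _ ⟨e, rfl⟩).2 m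
    refine ⟨f, k, hf, ?_⟩
    have h2 : ∀ v (hf : E.source f = v), σ (E.source f) (⟨f, rfl⟩, k) = σ v (⟨f, hf⟩, k) := by
      rintro _ rfl; rfl
    beta_reduce
    rw [h2 _ hf, h]

def coding : Edge → ℕ → ℕ := E.exists_coding.choose

variable {E} in
theorem coding_inj {e f : Edge} {k l : ℕ} (hs : E.source e = E.source f)
    (h : E.coding e k = E.coding f l) : e = f ∧ k = l :=
  E.exists_coding.choose_spec.1 e f k l hs h

theorem coding_surj (e : Edge) (m : ℕ) : ∃ f k, E.source f = E.source e ∧ E.coding f k = m :=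
  E.exists_coding.choose_spec.2 e m

/-! ### A graded Cuntz-Krieger family with nonzero vertex projections -/

variable (V Edge) in
/-- Index set of the basis on which the graded Cuntz-Krieger family acts. -/
abbrev GradedIndex : Type u := V × ℕ × (Edge →₀ ℤ)

variable (V Edge) in
abbrev GradedSpace : Type u := lp (fun _ : GradedIndex V Edge => ℂ) 2

variable (Edge) in
abbrev FibreSpace : Type u := lp (fun _ : ℕ × (Edge →₀ ℤ) => ℂ) 2

variable (V Edge) in
abbrev δ : HilbertBasis (GradedIndex V Edge) ℂ (GradedSpace V Edge) := stdBasis _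

variable (Edge) in
abbrev fibreBasis : HilbertBasis (ℕ × (Edge →₀ ℤ)) ℂ (FibreSpace Edge) := stdBasis _

def vertexIndex (v : V) (i : ℕ × (Edge →₀ ℤ)) : GradedIndex V Edge := (v, i)

/-- The coding splits the fibre over a vertex into infinite pieces, one per emitted edge, as the
relation for the sum of range projections demands. The last coordinate counts occurrences of each
edge. Being free, this grading can later be evaluated at any labelling. -/
def edgeIndex (e : Edge) (i : ℕ × (Edge →₀ ℤ)) : GradedIndex V Edge :=
  (E.source e, E.coding e i.1, i.2 + Finsupp.single e 1)

theorem vertexIndex_injective (v : V) :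
    Function.Injective (vertexIndex (Edge := Edge) v) := fun _ _ h => (Prod.mk.inj h).2

theorem edgeIndex_injective (e : Edge) : Function.Injective (E.edgeIndex e) := by
  rintro ⟨k, n⟩ ⟨l, m⟩ h
  simp only [edgeIndex, Prod.mk.injEq, true_and, add_left_inj] at h
  exact Prod.ext (coding_inj rfl h.1).2 h.2

def vertexIsometry (v : V) : FibreSpace Edge →L[ℂ] GradedSpace V Edge :=
  basisIsometry (fibreBasis Edge) ((δ V Edge).orthonormal.comp _ (vertexIndex_injective v))

def edgeIsometry (e : Edge) : FibreSpace Edge →L[ℂ] GradedSpace V Edge :=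
  basisIsometry (fibreBasis Edge) ((δ V Edge).orthonormal.comp _ (E.edgeIndex_injective e))

open ContinuousLinearMap

theorem vertexIsometry_apply (v : V) (i) :
    vertexIsometry v (fibreBasis Edge i) = δ V Edge (vertexIndex v i) :=
  basisIsometry_apply _ _ i

theorem edgeIsometry_apply (e : Edge) (i) :
    E.edgeIsometry e (fibreBasis Edge i) = δ V Edge (E.edgeIndex e i) :=
  basisIsometry_apply _ _ i

theorem adjoint_vertexIsometry_comp (v : V) :
    adjoint (vertexIsometry v) ∘L vertexIsometry (Edge := Edge) v = 1 :=
  adjoint_basisIsometry_comp_self _ _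

theorem adjoint_edgeIsometry_comp (e : Edge) :
    adjoint (E.edgeIsometry e) ∘L E.edgeIsometry e = 1 :=
  adjoint_basisIsometry_comp_self _ _

theorem adjoint_vertexIsometry_apply (v : V) (i) :
    adjoint (vertexIsometry v) (δ V Edge (v, i)) = fibreBasis Edge i :=
  adjoint_basisIsometry_apply (fibreBasis Edge) _ i

theorem adjoint_edgeIsometry_apply (e : Edge) (i) :
    adjoint (E.edgeIsometry e) (δ V Edge (E.edgeIndex e i)) = fibreBasis Edge i :=
  adjoint_basisIsometry_apply (fibreBasis Edge) _ i

theorem adjoint_vertexIsometry_apply_of_ne {v : V} {x : GradedIndex V Edge} (h : x.1 ≠ v) :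
    adjoint (vertexIsometry v) (δ V Edge x) = 0 :=
  adjoint_basisIsometry_eq_zero _ _ fun _ => (δ V Edge).orthonormal.2 fun h' => h (by rw [← h']; rfl)

theorem adjoint_edgeIsometry_apply_of_ne {e : Edge} {x : GradedIndex V Edge}
    (h : ∀ i, E.edgeIndex e i ≠ x) : adjoint (E.edgeIsometry e) (δ V Edge x) = 0 :=
  adjoint_basisIsometry_eq_zero _ _ fun i => (δ V Edge).orthonormal.2 (h i)

/-- The graded Cuntz-Krieger family. -/
def gradedFamily : CuntzKriegerFamily E (GradedSpace V Edge →L[ℂ] GradedSpace V Edge) where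
  P v := vertexIsometry v ∘L adjoint (vertexIsometry v)
  S e := E.edgeIsometry e ∘L adjoint (vertexIsometry (E.range e))
  isStarProjection v := by
    constructor
    · change (vertexIsometry v ∘L adjoint (vertexIsometry v)) ∘L
        (vertexIsometry v ∘L adjoint (vertexIsometry v)) = _
      rw [comp_assoc, ← comp_assoc (adjoint _), adjoint_vertexIsometry_comp]; rfl
    · change adjoint _ = _
      rw [adjoint_comp, adjoint_adjoint]
  orthogonal v w h := hilbertBasis_ext (δ V Edge) fun x => by
    obtain ⟨x, i⟩ := x
    change vertexIsometry v (adjoint (vertexIsometry v) (vertexIsometry w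
      (adjoint (vertexIsometry w) (δ V Edge (x, i))))) = 0
    by_cases hx : x = w
    · subst hx
      rw [adjoint_vertexIsometry_apply, vertexIsometry_apply,
        adjoint_vertexIsometry_apply_of_ne (fun h' => h h'.symm), map_zero]
    · rw [adjoint_vertexIsometry_apply_of_ne hx, map_zero, map_zero, map_zero]
  partialIsometry e := by
    have h : star (E.edgeIsometry e ∘L adjoint (vertexIsometry (E.range e))) =
        vertexIsometry (E.range e) ∘L adjoint (E.edgeIsometry e) := by
      rw [star_eq_adjoint, adjoint_comp, adjoint_adjoint]
    rw [h]
    refine ContinuousLinearMap.ext fun ξ => ?_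
    have h1 := fun x => DFunLike.congr_fun (adjoint_vertexIsometry_comp (Edge := Edge) (E.range e)) x
    have h2 := fun x => DFunLike.congr_fun (E.adjoint_edgeIsometry_comp e) x
    simp only [ContinuousLinearMap.comp_apply, one_apply_eq_self] at h1 h2
    simp only [mul_apply_eq_comp, ContinuousLinearMap.comp_apply, h1, h2]
  star_mul_self e := by
    have h : star (E.edgeIsometry e ∘L adjoint (vertexIsometry (E.range e))) =
        vertexIsometry (E.range e) ∘L adjoint (E.edgeIsometry e) := by
      rw [star_eq_adjoint, adjoint_comp, adjoint_adjoint]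
    rw [h]
    refine ContinuousLinearMap.ext fun ξ => ?_
    have h2 := fun x => DFunLike.congr_fun (E.adjoint_edgeIsometry_comp e) x
    simp only [ContinuousLinearMap.comp_apply, one_apply_eq_self] at h2
    simp only [mul_apply_eq_comp, ContinuousLinearMap.comp_apply, h2]
  sum_emitted v hv := by
    obtain ⟨e₀, rfl⟩ := hv
    have h : ∀ e, (E.edgeIsometry e ∘L adjoint (vertexIsometry (E.range e))) *
        star (E.edgeIsometry e ∘L adjoint (vertexIsometry (E.range e))) =
        E.edgeIsometry e ∘L adjoint (E.edgeIsometry e) := fun e => by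
      rw [star_eq_adjoint, adjoint_comp, adjoint_adjoint]
      refine ContinuousLinearMap.ext fun ξ => ?_
      have h1 := fun x =>
        DFunLike.congr_fun (adjoint_vertexIsometry_comp (Edge := Edge) (E.range e)) x
      simp only [ContinuousLinearMap.comp_apply, one_apply_eq_self] at h1
      simp only [mul_apply_eq_comp, ContinuousLinearMap.comp_apply, h1]
    rw [Finset.sum_congr rfl fun e _ => h e]
    refine hilbertBasis_ext (δ V Edge) fun x => ?_
    obtain ⟨x, m, n⟩ := x
    rw [sum_apply]
    by_cases hx : x = E.source e₀
    · subst hx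
      rw [ContinuousLinearMap.comp_apply, adjoint_vertexIsometry_apply, vertexIsometry_apply]
      obtain ⟨f, k, hs, hk⟩ := E.coding_surj e₀ m
      -- Exactly one emitted edge has this basis vector in its range. Integer degrees make the
      -- subtraction legitimate.
      have hfi : E.edgeIndex f (k, n - Finsupp.single f 1) = (E.source e₀, m, n) := by
        simp [edgeIndex, hs, hk]
      rw [Finset.sum_eq_single f, ← hfi, ContinuousLinearMap.comp_apply,
        adjoint_edgeIsometry_apply, edgeIsometry_apply, hfi]
      · rfl
      · intro e he hne
        have hse : E.source e = E.source e₀ := by simpa [emitted] using he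
        rw [ContinuousLinearMap.comp_apply, adjoint_edgeIsometry_apply_of_ne, map_zero]
        rintro ⟨l, n'⟩ h'
        simp only [edgeIndex, Prod.mk.injEq] at h'
        exact hne (coding_inj (hse.trans hs.symm) (h'.2.1.trans hk.symm)).1
      · intro hf
        simp [emitted, hs] at hf
    · rw [ContinuousLinearMap.comp_apply, adjoint_vertexIsometry_apply_of_ne hx, map_zero,
        Finset.sum_eq_zero]
      intro e he
      have hse : E.source e = E.source e₀ := by simpa [emitted] using he
      rw [ContinuousLinearMap.comp_apply, adjoint_edgeIsometry_apply_of_ne, map_zero]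
      rintro i h'
      exact hx ((congrArg Prod.fst h').symm.trans hse)

theorem gradedFamily_P_apply_self (v : V) (i) :
    E.gradedFamily.P v (δ V Edge (v, i)) = δ V Edge (v, i) := by
  change vertexIsometry v (adjoint (vertexIsometry v) (δ V Edge (v, i))) = _
  rw [adjoint_vertexIsometry_apply, vertexIsometry_apply]; rfl

theorem gradedFamily_P_apply_of_ne {v : V} {x : GradedIndex V Edge} (h : x.1 ≠ v) :
    E.gradedFamily.P v (δ V Edge x) = 0 := by
  change vertexIsometry v (adjoint (vertexIsometry v) (δ V Edge x)) = _
  rw [adjoint_vertexIsometry_apply_of_ne h, map_zero]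

theorem gradedFamily_S_apply (e : Edge) (i) :
    E.gradedFamily.S e (δ V Edge (E.range e, i)) = δ V Edge (E.edgeIndex e i) := by
  change E.edgeIsometry e (adjoint (vertexIsometry _) (δ V Edge (_, i))) = _
  rw [adjoint_vertexIsometry_apply, edgeIsometry_apply]

theorem gradedFamily_S_apply_of_ne {e : Edge} {x : GradedIndex V Edge} (h : x.1 ≠ E.range e) :
    E.gradedFamily.S e (δ V Edge x) = 0 := by
  change E.edgeIsometry e (adjoint (vertexIsometry _) (δ V Edge x)) = _
  rw [adjoint_vertexIsometry_apply_of_ne h, map_zero]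

end RowFiniteGraph

end

end QuasiFree

namespace QuasiFree

noncomputable section

/-! ### Diagonal unitary representations -/

section Diagonal

open ContinuousLinearMap

/-- Conjugation by an isometry. -/
def isometryConj {H H' : Type*} [NormedAddCommGroup H] [InnerProductSpace ℂ H] [CompleteSpace H]
    [NormedAddCommGroup H'] [InnerProductSpace ℂ H'] [CompleteSpace H'] (W : H →L[ℂ] H')
    (hW : adjoint W ∘L W = 1) : (H →L[ℂ] H) →⋆ₙₐ[ℂ] (H' →L[ℂ] H') where
  toFun a := W ∘L a ∘L adjoint W
  map_smul' c a := by rw [smul_comp, comp_smul]; rfl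
  map_zero' := by rw [zero_comp, comp_zero]
  map_add' a b := by rw [add_comp, comp_add]
  map_mul' a b := by
    refine ContinuousLinearMap.ext fun ξ => ?_
    have h : ∀ x, adjoint W (W x) = x := DFunLike.congr_fun hW
    simp only [mul_apply_eq_comp, ContinuousLinearMap.comp_apply, h]
  map_star' a := by
    rw [star_eq_adjoint, star_eq_adjoint, adjoint_comp, adjoint_comp, adjoint_adjoint, comp_assoc]

variable {ι : Type*} {H : Type*} [NormedAddCommGroup H] [InnerProductSpace ℂ H]

theorem orthonormal_circle_smul (b : HilbertBasis ι ℂ H) (c : ι → Circle) :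
    Orthonormal ℂ fun i => (c i : ℂ) • b i := by
  refine ⟨fun i => ?_, fun i j hij => ?_⟩
  · rw [norm_smul, Circle.norm_coe, b.orthonormal.1, one_mul]
  · change inner ℂ ((c i : ℂ) • b i) ((c j : ℂ) • b j) = 0
    rw [inner_smul_left, inner_smul_right, b.orthonormal.2 hij, mul_zero, mul_zero]

variable [CompleteSpace H]

/-- The diagonal operator with entries of modulus one. -/
def diagonal (b : HilbertBasis ι ℂ H) (c : ι → Circle) : H →L[ℂ] H :=
  basisIsometry b (orthonormal_circle_smul b c)

theorem diagonal_apply (b : HilbertBasis ι ℂ H) (c : ι → Circle) (i : ι) :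
    diagonal b c (b i) = (c i : ℂ) • b i :=
  basisIsometry_apply _ _ i

theorem diagonal_one (b : HilbertBasis ι ℂ H) : diagonal b 1 = 1 :=
  hilbertBasis_ext b fun i => by
    rw [diagonal_apply, Pi.one_apply, Circle.coe_one, one_smul]; rfl

theorem diagonal_mul (b : HilbertBasis ι ℂ H) (c d : ι → Circle) :
    diagonal b (c * d) = diagonal b c * diagonal b d :=
  hilbertBasis_ext b fun i => by
    rw [mul_apply_eq_comp, diagonal_apply, diagonal_apply, map_smul, diagonal_apply, smul_smul,
      Pi.mul_apply, Circle.coe_mul, mul_comm]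

theorem star_diagonal (b : HilbertBasis ι ℂ H) (c : ι → Circle) :
    star (diagonal b c) = diagonal b c⁻¹ := by
  have h1 : star (diagonal b c) * diagonal b c = 1 := adjoint_basisIsometry_comp_self _ _
  calc star (diagonal b c) = star (diagonal b c) * (diagonal b c * diagonal b c⁻¹) := by
        rw [← diagonal_mul, mul_inv_cancel, diagonal_one, mul_one]
    _ = diagonal b c⁻¹ := by rw [← mul_assoc, h1, one_mul]

theorem norm_diagonal_apply (b : HilbertBasis ι ℂ H) (c : ι → Circle) (ξ : H) :
    ‖diagonal b c ξ‖ = ‖ξ‖ :=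
  LinearIsometry.norm_map _ ξ

/-- The unitary representation given by characters on the vectors of a Hilbert basis. -/
def diagonalRep {G : Type*} [Monoid G] (b : HilbertBasis ι ℂ H) (χ : ι → G →* Circle) :
    G →* unitary (H →L[ℂ] H) where
  toFun t := ⟨diagonal b fun i => χ i t, by
    have h : (fun i => χ i t)⁻¹ * (fun i => χ i t) = 1 := inv_mul_cancel _
    constructor
    · rw [star_diagonal, ← diagonal_mul, h, diagonal_one]
    · rw [star_diagonal, ← diagonal_mul, mul_comm, h, diagonal_one]⟩
  map_one' := Subtype.ext (by
    have h : (fun i => χ i 1) = (1 : ι → Circle) := funext fun i => map_one (χ i)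
    change diagonal b _ = 1
    rw [h, diagonal_one])
  map_mul' s t := Subtype.ext (by
    have h : (fun i => χ i (s * t)) = (fun i => χ i s) * fun i => χ i t :=
      funext fun i => map_mul (χ i) s t
    change diagonal b _ = diagonal b _ * diagonal b _
    rw [h, diagonal_mul])

/-- Each diagonal operator is isometric, so approximating `ξ` by finite combinations of basis
vectors is uniform in the parameter. -/
theorem continuous_diagonal {X : Type*} [TopologicalSpace X] (b : HilbertBasis ι ℂ H)
    (c : X → ι → Circle) (hc : ∀ i, Continuous fun t => c t i) (ξ : H) :
    Continuous fun t => diagonal b (c t) ξ := by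
  refine continuous_of_uniform_approx_of_continuous fun u hu => ?_
  obtain ⟨ε, hε, hεu⟩ := Metric.mem_uniformity_dist.1 hu
  have hξ : ξ ∈ closure (Submodule.span ℂ (Set.range b) : Set H) :=
    Submodule.dense_iff_topologicalClosure_eq_top.2 b.dense_span ξ
  obtain ⟨η, hη, hd⟩ := Metric.mem_closure_iff.1 hξ ε hε
  refine ⟨fun t => diagonal b (c t) η, ?_, fun t => hεu ?_⟩
  · refine Submodule.span_induction (p := fun η _ => Continuous fun t => diagonal b (c t) η)
      ?_ ?_ ?_ ?_ hη
    · rintro _ ⟨i, rfl⟩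
      simp only [diagonal_apply]
      exact (continuous_circle_coe.comp (hc i)).smul continuous_const
    · simp only [map_zero]; exact continuous_const
    · intro x y _ _ hx hy; simp only [map_add]; exact hx.add hy
    · intro a x _ hx; simp only [map_smul]; exact hx.const_smul a
  · rw [dist_eq_norm, ← map_sub, norm_diagonal_apply, ← dist_eq_norm]
    exact hd

end Diagonal

/-! ### The covariant representation on the graded space -/

namespace RowFiniteGraph

open ContinuousLinearMap CStarDynamicalSystem

variable {V Edge : Type u} {E : RowFiniteGraph V Edge} {G : Type v} [CommGroup G]
  [TopologicalSpace G] (ω : E.LabellingMap (PontryaginDual G))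

/-- The character attached to a degree. -/
def degreeCharacter (n : Edge →₀ ℤ) : PontryaginDual G :=
  n.prod fun e m => ω (E.edgePath e) ^ m

theorem degreeCharacter_add_single (n : Edge →₀ ℤ) (e : Edge) :
    degreeCharacter ω (n + Finsupp.single e 1) = degreeCharacter ω n * ω (E.edgePath e) := by
  classical
  rw [degreeCharacter, Finsupp.prod_add_index' (fun _ => zpow_zero _) (fun _ _ _ => zpow_add _ _ _),
    Finsupp.prod_single_index (zpow_zero _), zpow_one, degreeCharacter]

theorem degreeCharacter_zero : degreeCharacter ω 0 = 1 := Finsupp.prod_zero_index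

variable (V Edge) in
-- The lift is for universes only: the graph algebra lives in `Type (u + 1)`, and covariant
-- representations act on spaces in the joint universe of algebra and group.
abbrev LiftedIndex : Type (max (u + 1) v) := ULift.{max (u + 1) v} (GradedIndex V Edge)

variable (V Edge) in
abbrev LiftedSpace : Type (max (u + 1) v) := lp (fun _ : LiftedIndex.{u, v} V Edge => ℂ) 2

variable (V Edge) in
abbrev liftedBasis : HilbertBasis (LiftedIndex.{u, v} V Edge) ℂ (LiftedSpace.{u, v} V Edge) :=
  stdBasis _

variable (V Edge) in
def liftIsometry : GradedSpace V Edge →L[ℂ] LiftedSpace.{u, v} V Edge :=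
  basisIsometry (δ V Edge) ((liftedBasis V Edge).orthonormal.comp _ ULift.up_injective)

theorem liftIsometry_apply (x : GradedIndex V Edge) :
    liftIsometry V Edge (δ V Edge x) = liftedBasis.{u, v} V Edge ⟨x⟩ :=
  basisIsometry_apply _ _ x

theorem adjoint_liftIsometry_apply (x : LiftedIndex.{u, v} V Edge) :
    adjoint (liftIsometry V Edge) (liftedBasis.{u, v} V Edge x) = δ V Edge x.down :=
  adjoint_basisIsometry_apply (δ V Edge) _ x.down

variable (E) in
def gradedRep : CKRep E := ⟨GradedSpace V Edge, E.gradedFamily⟩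

/-- The representation of the graph C*-algebra given by the graded Cuntz-Krieger family. -/
def liftedRep : E.GraphAlgebra →⋆ₙₐ[ℂ]
    (LiftedSpace.{u, v} V Edge →L[ℂ] LiftedSpace.{u, v} V Edge) :=
  (isometryConj (liftIsometry V Edge) (adjoint_basisIsometry_comp_self _ _)).comp
    (GraphAlgebra.rep E.gradedRep)

theorem liftedRep_apply (a : E.GraphAlgebra) (x : LiftedIndex.{u, v} V Edge)
    (T : GradedSpace V Edge →L[ℂ] GradedSpace V Edge) (hT : GraphAlgebra.rep E.gradedRep a = T) :
    liftedRep a (liftedBasis V Edge x) = liftIsometry V Edge (T (δ V Edge x.down)) := by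
  subst hT
  change liftIsometry V Edge ((GraphAlgebra.rep E.gradedRep a :
    GradedSpace V Edge →L[ℂ] GradedSpace V Edge) (adjoint (liftIsometry V Edge) _)) = _
  rw [adjoint_liftIsometry_apply]
  rfl

theorem liftedRep_p_apply (v : V) (x : LiftedIndex.{u, v} V Edge) :
    liftedRep (GraphAlgebra.p E v) (liftedBasis V Edge x) =
      liftIsometry V Edge (E.gradedFamily.P v (δ V Edge x.down)) :=
  liftedRep_apply _ _ _ rfl

theorem liftedRep_s_apply (e : Edge) (x : LiftedIndex.{u, v} V Edge) :
    liftedRep (GraphAlgebra.s E e) (liftedBasis V Edge x) =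
      liftIsometry V Edge (E.gradedFamily.S e (δ V Edge x.down)) :=
  liftedRep_apply _ _ _ rfl

def liftedUnitary : G →* unitary (LiftedSpace.{u, v} V Edge →L[ℂ] LiftedSpace.{u, v} V Edge) :=
  diagonalRep (liftedBasis V Edge) fun x => (degreeCharacter ω x.down.2.2 : G →* Circle)

theorem liftedUnitary_apply (t : G) (x : LiftedIndex.{u, v} V Edge) :
    (liftedUnitary ω t : LiftedSpace.{u, v} V Edge →L[ℂ] LiftedSpace.{u, v} V Edge)
      (liftedBasis V Edge x) = (degreeCharacter ω x.down.2.2 t : ℂ) • liftedBasis V Edge x :=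
  diagonal_apply _ _ x

theorem liftedUnitary_mul_P (t : G) (v : V) :
    (liftedUnitary ω t : LiftedSpace.{u, v} V Edge →L[ℂ] LiftedSpace.{u, v} V Edge) *
      liftedRep (GraphAlgebra.p E v) = liftedRep (GraphAlgebra.p E v) * liftedUnitary ω t :=
  hilbertBasis_ext (liftedBasis V Edge) fun x => by
    obtain ⟨x, i⟩ := x
    rw [mul_apply_eq_comp, mul_apply_eq_comp, liftedUnitary_apply, map_smul,
      liftedRep_p_apply]
    by_cases hx : x = v
    · subst hx
      rw [gradedFamily_P_apply_self, liftIsometry_apply, liftedUnitary_apply]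
    · rw [E.gradedFamily_P_apply_of_ne (x := (x, i)) hx, map_zero, map_zero, smul_zero]

/-- `S e` raises the degree by `e`, so the diagonal unitary picks up exactly the label of `e`. -/
theorem liftedUnitary_mul_S (t : G) (e : Edge) :
    (liftedUnitary ω t : LiftedSpace.{u, v} V Edge →L[ℂ] LiftedSpace.{u, v} V Edge) *
      liftedRep (GraphAlgebra.s E e) =
        (ω (E.edgePath e) t : ℂ) • (liftedRep (GraphAlgebra.s E e) * liftedUnitary ω t) :=
  hilbertBasis_ext (liftedBasis V Edge) fun x => by
    obtain ⟨x, i⟩ := x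
    rw [smul_apply, mul_apply_eq_comp, mul_apply_eq_comp, liftedUnitary_apply, map_smul,
      liftedRep_s_apply]
    by_cases hx : x = E.range e
    · subst hx
      rw [gradedFamily_S_apply, liftIsometry_apply, liftedUnitary_apply]
      change (degreeCharacter ω (i.2 + Finsupp.single e 1) t : ℂ) • _ = _
      rw [degreeCharacter_add_single, smul_smul, mul_comm (_ : ℂ)]
      rfl
    · rw [E.gradedFamily_S_apply_of_ne (x := (x, i)) hx, map_zero, map_zero, smul_zero, smul_zero]

/-- The covariant representation given by the graded Cuntz-Krieger family. -/
def gradedCovariantRep : (E.quasiFreeAction ω).CovariantRep where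
  K := LiftedSpace.{u, v} V Edge
  π := liftedRep
  U := liftedUnitary ω
  continuous_U ξ := continuous_diagonal (liftedBasis V Edge) _
    (fun x => map_continuous (degreeCharacter ω x.down.2.2)) ξ
  covariant t a := by
    let U : LiftedSpace.{u, v} V Edge →L[ℂ] LiftedSpace.{u, v} V Edge := liftedUnitary ω t
    have h1 : star U * U = 1 := Unitary.star_mul_self_of_mem (liftedUnitary ω t).2
    have h2 : U * star U = 1 := Unitary.mul_star_self_of_mem (liftedUnitary ω t).2
    let φ : E.GraphAlgebra →⋆ₙₐ[ℂ]
        (LiftedSpace.{u, v} V Edge →L[ℂ] LiftedSpace.{u, v} V Edge) :=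
      (isometryConj U h1).comp liftedRep
    have hφ : ∀ a, φ a = U * liftedRep a * star U := fun _ => rfl
    let ψ : E.GraphAlgebra →⋆ₙₐ[ℂ]
        (LiftedSpace.{u, v} V Edge →L[ℂ] LiftedSpace.{u, v} V Edge) :=
      { toFun := fun a => liftedRep ((E.quasiFreeAction ω).action t a)
        map_smul' := fun c a => by rw [map_smul, map_smul]; rfl
        map_zero' := by rw [map_zero, map_zero]
        map_add' := fun a b => by rw [map_add, map_add]
        map_mul' := fun a b => by rw [map_mul, map_mul]
        map_star' := fun a => by rw [map_star, map_star] }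
    -- Both sides of covariance are *-homomorphisms, so comparing generators is enough.
    have hφψ : ψ = φ := by
      refine GraphAlgebra.hom_ext (fun v => ?_) (fun e => ?_)
      · rw [hφ]
        change liftedRep (GraphAlgebra.p E v) = _
        rw [liftedUnitary_mul_P, mul_assoc, h2, mul_one]
      · rw [hφ]
        change liftedRep ((ω (E.edgePath e) t : ℂ) • GraphAlgebra.s E e) = _
        rw [liftedUnitary_mul_S, smul_mul_assoc, mul_assoc, h2, mul_one, map_smul]
    exact DFunLike.congr_fun hφψ a

/-- Every vertex projection and every character have a common eigenvector in some covariant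
representation. -/
theorem exists_eigenvector (v : V) (θ : PontryaginDual G) :
    ∃ (ρ : (E.quasiFreeAction ω).CovariantRep) (ξ : ρ.K), ξ ≠ 0 ∧
      ρ.π (GraphAlgebra.p E v) ξ = ξ ∧
      ∀ t, (ρ.U t : ρ.K →L[ℂ] ρ.K) ξ = (θ t : ℂ) • ξ := by
  -- The diagonal unitaries fix a vector of degree zero; twisting by `θ` then produces any
  -- prescribed character.
  refine ⟨(gradedCovariantRep ω).twist θ, liftedBasis.{u, v} V Edge ⟨(v, 0, 0)⟩, ?_, ?_,
    fun t => ?_⟩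
  · exact (liftedBasis.{u, v} V Edge).orthonormal.ne_zero _
  · change liftedRep (GraphAlgebra.p E v) (liftedBasis.{u, v} V Edge _) = _
    rw [liftedRep_p_apply, gradedFamily_P_apply_self, liftIsometry_apply]
  · change (θ t : ℂ) • (liftedUnitary ω t :
      LiftedSpace.{u, v} V Edge →L[ℂ] LiftedSpace.{u, v} V Edge)
      (liftedBasis.{u, v} V Edge _) = _
    rw [liftedUnitary_apply]
    change (θ t : ℂ) • (degreeCharacter ω 0 t : ℂ) • _ = _
    rw [degreeCharacter_zero, PontryaginDual.one_apply, Circle.coe_one, one_smul]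
    rfl

end RowFiniteGraph

/-! ### Infinite projections from loops with an exit -/

open RowFiniteGraph CStarDynamicalSystem GraphAlgebra

variable {V Edge : Type u} {E : RowFiniteGraph V Edge} {G : Type v} [CommGroup G]
  [TopologicalSpace G] [IsTopologicalGroup G] [LocallyCompactSpace G] [MeasurableSpace G]
  [BorelSpace G]

/-- A loop with an exit whose label fixes a compact open set of characters gives an infinite
projection in the crossed product. -/
theorem exists_isInfiniteProjection (ω : E.LabellingMap (PontryaginDual G)) {γ : E.Path}
    (hloop : γ.IsLoop) (hexit : γ.HasExit) {O : Set (PontryaginDual G)} (hne : O.Nonempty)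
    (hc : IsCompact O) (ho : IsOpen O) (hfix : ω γ • O = O) :
    ∃ q : (E.quasiFreeAction ω).CrossedProduct, IsInfiniteProjection q := by
  let α := E.quasiFreeAction ω
  obtain ⟨P, hP, hmem, hcomm, heig⟩ := CStarDynamicalSystem.exists_projection (α := α) hc ho
  let v := γ.source
  let S : E.GraphAlgebra := pathOp E v γ.edges
  let T : α.UniversalFamily := α.representFamily S
  let p : α.UniversalFamily := α.representFamily (p E v)
  have hSS : star S * S = GraphAlgebra.p E v := by
    rw [star_pathOp_mul_self γ.isPath]
    exact congrArg _ hloop.2.symm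
  have hTT : star T * T = p := by rw [← map_star, ← map_mul, hSS]
  have hp : IsStarProjection p := (isStarProjection_p v).map α.representFamily
  have hpT : p * T = T := by rw [← map_mul, p_mul_pathOp γ.isPath]
  have hPP : P * P = P := hP.isIdempotentElem
  have hPs : star P = P := hP.isSelfAdjoint
  have hPT : P * T = T * P := hcomm (ω γ) S hfix fun t => by
    rw [action_pathOp, ω.map_path γ]
  have hTsP : star T * P = P * star T := by
    have := congrArg star hPT
    rwa [star_mul, star_mul, hPs] at this
  have hPp : P * p = p * P := by rw [← hTT, ← mul_assoc, ← hTsP, mul_assoc, hPT, mul_assoc]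
  -- the isometry `x` of the corner
  have hxx : star (T * P) * (T * P) = p * P := by
    rw [star_mul, hPs, mul_assoc, ← mul_assoc (star T), hTT, ← mul_assoc, hPp, mul_assoc, hPP]
  have hxx' : T * P * star (T * P) = T * star T * P := by
    rw [star_mul, hPs, mul_assoc, ← mul_assoc P, hPP, ← hTsP, mul_assoc]
  have hproj : IsStarProjection (p * P) := by
    constructor
    · change p * P * (p * P) = p * P
      rw [mul_assoc, ← mul_assoc P, hPp, mul_assoc, hPP, ← mul_assoc, hp.isIdempotentElem.eq]
    · change star (p * P) = p * P
      rw [star_mul, hPs, hp.isSelfAdjoint.star_eq, hPp]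
  have hTTT : T * star T * T = T := by
    have hTp : T * p = T := by
      have : star (T * p - T) * (T * p - T) = 0 := by
        have e : star (T * p - T) * (T * p - T) =
          star p * (star T * T) * p - star p * (star T * T) - (star T * T) * p + star T * T := by
          simp only [star_sub, star_mul]; noncomm_ring
        rw [e, hTT, hp.isSelfAdjoint.star_eq, hp.isIdempotentElem.eq, hp.isIdempotentElem.eq]
        abel
      exact sub_eq_zero.1 ((CStarRing.star_mul_self_eq_zero_iff _).1 this)
    rw [mul_assoc, hTT, hTp]
  have hproj' : IsStarProjection (T * star T * P) := by
    have hcomm' : P * (T * star T) = T * star T * P := by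
      rw [← mul_assoc, hPT, mul_assoc, ← hTsP, mul_assoc]
    constructor
    · change T * star T * P * (T * star T * P) = T * star T * P
      calc T * star T * P * (T * star T * P) = T * star T * (P * (T * star T)) * P := by
            simp only [mul_assoc]
        _ = T * star T * T * star T * (P * P) := by rw [hcomm']; simp only [mul_assoc]
        _ = T * star T * P := by rw [hTTT, hPP]
    · change star (T * star T * P) = T * star T * P
      rw [star_mul, hPs, star_mul, star_star, hcomm']
  have hle : p * P * (T * star T * P) = T * star T * P := by
    have : P * (T * star T * P) = T * star T * P := by
      rw [mul_assoc, ← mul_assoc, hPT, mul_assoc, ← mul_assoc P, ← hTsP, mul_assoc, hPP]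
    rw [mul_assoc, this, ← mul_assoc, ← mul_assoc, hpT]
  -- The two projections are told apart by a vector `η` in the range of a path operator orthogonal
  -- to that of the loop.
  have hneq : T * star T * P ≠ p * P := by
    obtain ⟨e, he, f, hs, hfe⟩ := hexit
    obtain ⟨m, hm, horth⟩ := exists_orthogonal_path γ.isPath he hs hfe
    obtain ⟨θ, hθ⟩ := hne
    let κ := (m.map fun e => ω (E.edgePath e)).prod
    -- Applying the path operator of `m` multiplies the character by `κ`; starting from `κ⁻¹ * θ`
    -- makes `η` land on `θ`, a point of `O`.
    obtain ⟨ρ, ξ, hξ, hpξ, hU⟩ := exists_eigenvector ω (E.endOf v m) (κ⁻¹ * θ)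
    let η := ρ.π (pathOp E v m) ξ
    have hη : η ≠ 0 := fun h0 => hξ (by
      rw [← hpξ, ← star_pathOp_mul_self hm, map_mul, mul_apply_eq_comp]
      change ρ.π _ η = 0
      rw [h0, map_zero])
    have hpη : ρ.π (GraphAlgebra.p E v) η = η := by
      change (ρ.π _ * ρ.π _) ξ = _
      rw [← map_mul, p_mul_pathOp hm]
    have hSη : ρ.π (star S) η = 0 := by
      change (ρ.π _ * ρ.π _) ξ = _
      rw [← map_mul, horth, map_zero]; rfl
    have hUη : ∀ t, (ρ.U t : ρ.K →L[ℂ] ρ.K) η = (θ t : ℂ) • η := fun t => by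
      rw [ρ.U_π_apply (χ := κ) (fun t => action_pathOp ω t v m), hU, map_smul, smul_smul,
        ← Circle.coe_mul]
      congr 2
      change κ t * (κ⁻¹ * θ) t = θ t
      change (κ * (κ⁻¹ * θ)) t = θ t
      rw [mul_inv_cancel_left]
    have hPη : P.component ρ η = η := heig ρ θ η hθ hUη
    intro h
    have h' := congrArg (fun x : α.UniversalFamily => x.component ρ η) h
    have hl : (T * star T * P).component ρ η = 0 := by
      change T.component ρ ((star T).component ρ (P.component ρ η)) = 0
      rw [hPη, ← map_star]
      change T.component ρ (ρ.π (star S) η) = 0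
      rw [hSη, map_zero]
    have hr : (p * P).component ρ η = η := by
      change p.component ρ (P.component ρ η) = η
      rw [hPη]
      exact hpη
    exact hη (hr.symm.trans (h'.symm.trans hl))
  -- Only products with `P` lie in the crossed product, so the projection is taken to be `star x *
  -- x`.
  let x : α.CrossedProduct := ⟨T * P, hmem S⟩
  have hx1 : (star x * x).1 = p * P := hxx
  have hx2 : (x * star x).1 = T * star T * P := hxx'
  refine ⟨star x * x, ⟨Subtype.ext ?_, Subtype.ext ?_⟩, x, rfl, ⟨Subtype.ext ?_, Subtype.ext ?_⟩,
    Subtype.ext ?_, fun h => ?_⟩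
  · change (star x * x).1 * (star x * x).1 = (star x * x).1
    rw [hx1]; exact hproj.isIdempotentElem
  · change star (star x * x).1 = (star x * x).1
    rw [hx1]; exact hproj.isSelfAdjoint
  · change (x * star x).1 * (x * star x).1 = (x * star x).1
    rw [hx2]; exact hproj'.isIdempotentElem
  · change star (x * star x).1 = (x * star x).1
    rw [hx2]; exact hproj'.isSelfAdjoint
  · change (star x * x).1 * (x * star x).1 = (x * star x).1
    rw [hx1, hx2]; exact hle
  · have := congrArg Subtype.val h
    exact hneq (hx2.symm.trans (this.trans hx1))

end

end QuasiFree

/-! ### The theorem -/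

open QuasiFree in
theorem proposition2p4 {V Edge : Type u} [Countable V] [Countable Edge]
    (E : RowFiniteGraph V Edge)
    {G : Type v} [CommGroup G] [TopologicalSpace G] [IsTopologicalGroup G]
    [LocallyCompactSpace G] [T2Space G] [SecondCountableTopology G]
    [MeasurableSpace G] [BorelSpace G]
    (ω : E.LabellingMap (PontryaginDual G)) :
    -- an embedding in an AF algebra rules out infinite projections
    (∀ (D : Type w) [NonUnitalCStarAlgebra D], IsAFAlgebra D →
      EmbedsIn (E.quasiFreeAction ω).CrossedProduct D →
      HasNoInfiniteProjection (E.quasiFreeAction ω).CrossedProduct) ∧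
    (HasNoInfiniteProjection (E.quasiFreeAction ω).CrossedProduct →
      (∀ γ : E.Path, γ.IsLoop → γ.HasExit →
        ∀ O : Set (PontryaginDual G), O.Nonempty → IsCompact O → IsOpen O → ω γ • O ≠ O) ∧
      ((∃ O : Set (PontryaginDual G), O.Nonempty ∧ IsCompact O ∧ IsOpen O) →
        ∀ γ : E.Path, γ.IsLoop → γ.HasExit → ω γ ≠ 1)) ∧
    -- the dual of a compact group has a nonempty compact open subset
    (CompactSpace G →
      ∃ O : Set (PontryaginDual G), O.Nonempty ∧ IsCompact O ∧ IsOpen O) := by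
  have hfix : HasNoInfiniteProjection (E.quasiFreeAction ω).CrossedProduct →
      ∀ γ : E.Path, γ.IsLoop → γ.HasExit → ∀ O : Set (PontryaginDual G),
        O.Nonempty → IsCompact O → IsOpen O → ω γ • O ≠ O :=
    fun h γ hl he O hne hc ho hO =>
      have ⟨q, hq⟩ := exists_isInfiniteProjection ω hl he hne hc ho hO
      h q hq
  refine ⟨fun D _ hD hE => hE.hasNoInfiniteProjection hD.hasNoInfiniteProjection,
    -- The dual of a compact group is discrete, so a singleton is compact and open.
    fun h => ⟨hfix h, ?_⟩, fun _ => ⟨{1}, Set.singleton_nonempty _, isCompact_singleton,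
      isOpen_discrete _⟩⟩
  rintro ⟨O, hne, hc, ho⟩ γ hl he h1
  -- A trivial label would fix every set of characters, in particular `O`.
  exact hfix h γ hl he O hne hc ho (by rw [h1, one_smul])
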